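/- Let $n\ge 2$. Cubes in $\mathbb{R}^n$ have sides parallel to the axes; $3Q$ is the cube with the same center as $Q$ and three times its side length, $\langle h\rangle_Q$ is the mean of $h$ over $Q$, $\langle|h|\rangle_{Q,s}=(\langle|h|^s\rangle_Q)^{1/s}$, and $p'=p/(p-1)$. A family $\mathcal S$ of cubes is $\eta$-sparse if there are pairwise disjoint measurable sets $E_Q\subset Q$ ($Q\in\mathcal S$) with $|E_Q|\ge\eta|Q|$. Put $$\|f\|_{L\log L,Q}=\inf\Big\{\lambda>0:\ \frac1{|Q|}\int_Q\frac{|f|}{\lambda}\log\Big(\mathrm e+\frac{|f|}{\lambda}\Big)\le1\Big\},$$ $$\mathcal A_{\mathcal S;L^1,L^{s}}(f,g)=\sum_{Q\in\mathcal S}|Q|\,\langle|f|\rangle_Q\langle|g|\rangle_{Q,s},\qquad \mathcal A_{\mathcal S;L\log L,L^{s}}(f,g)=\sum_{Q\in\mathcal S}|Q|\,\|f\|_{L\log L,Q}\langle|g|\rangle_{Q,s}.$$ For $b\in L^1_{\rm loc}(\mathbb{R}^n)$ let $\|b\|_{\rm BMO}=\sup_Q\langle|b-\langle b\rangle_Q|\rangle_Q$,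 and $b\in{\rm BMO}(\mathbb{R}^n)$ if this is finite. For a linear operator $T$ that maps $L^1(\mathbb{R}^n)$ to measurable functions (modulo equality almost everywhere), put $$\mathscr M_{p_0,T}f(x)=\sup_{Q\ni x}\Big(\frac1{|Q|}\int_Q|T(f\chi_{\mathbb{R}^n\setminus3Q})(\xi)|^{p_0}\,d\xi\Big)^{1/p_0},\qquad T_bf=b\,Tf-T(bf).$$ There is a constant $C$ depending only on $n$ such that the following holds. Let $p_0,r\in(1,\infty)$, let $b\in{\rm BMO}(\mathbb{R}^n)$, and let $T$ be a linear operator as above such that both $T$ and $\mathscr M_{p_0,T}$ are bounded from $L^1(\mathbb{R}^n)$ to $L^{1,\infty}(\mathbb{R}^n)$ with bound $1$, that is, $\sup_{\lambda>0}\lambda|\{|Uf|>\lambda\}|\le\|f\|_{L^1}$ for all $f\in L^1(\mathbb{R}^n)$ and $U\in\{T,\mathscr M_{p_0,T}\}$. Then for every bounded function $f$ with compact support there exist a $\frac12\frac1{3^n}$-sparse family $\mathcal S$ of cubes and measurable functions $H_1f$, $H_2f$ with $$T_bf(x)=H_1f(x)+H_2f(x)\quad\text{for a.e. }x\in\mathbb{R}^n,$$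 such that for each $g\in L^{rp_0'}_{\rm loc}(\mathbb{R}^n)$, $$\Big|\int_{\mathbb{R}^n}H_1f(x)g(x)\,dx\Big|\le C\,\|b\|_{\rm BMO}\,r'p_0'\,\mathcal A_{\mathcal S;L^1,L^{rp_0'}}(f,g),$$ $$\Big|\int_{\mathbb{R}^n}H_2f(x)g(x)\,dx\Big|\le C\,\|b\|_{\rm BMO}\,\mathcal A_{\mathcal S;L\log L,L^{p_0'}}(f,g),$$ where each integrand is integrable whenever the sparse form on the right of its inequality is finite (where the form is infinite, the inequality carries no claim). -/

import Mathlib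

open MeasureTheory
open scoped ENNReal NNReal

noncomputable section

namespace SparseCommutator

/-- A cube in `ℝⁿ` with sides parallel to the axes, given by its lower corner and its
(positive) side length. -/
structure Cube (n : ℕ) where
  corner : Fin n → ℝ
  side : ℝ
  side_pos : 0 < side

namespace Cube

variable {n : ℕ}

/-- The points of the cube, `∏ i, [aᵢ, aᵢ + ℓ)`. -/
def toSet (Q : Cube n) : Set (Fin n → ℝ) :=
  Set.univ.pi fun i => Set.Ico (Q.corner i) (Q.corner i + Q.side)

/-- The cube with the same center as `Q` and `t` times its side length. -/
def dilate (t : ℝ) (ht : 0 < t) (Q : Cube n) : Cube n where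
  corner := fun i => Q.corner i + Q.side / 2 - t * Q.side / 2
  side := t * Q.side
  side_pos := mul_pos ht Q.side_pos

/-- The cube `3Q`. -/
def triple (Q : Cube n) : Cube n := Q.dilate 3 (by norm_num)

theorem measurableSet_toSet (Q : Cube n) : MeasurableSet Q.toSet :=
  MeasurableSet.univ_pi fun _ => measurableSet_Ico

end Cube

variable {n : ℕ} {𝕜 : Type*} [RCLike 𝕜]

/-- The mean `|Q|⁻¹ ∫_Q F` of a nonnegative function over a cube. -/
def cubeMean (Q : Cube n) (F : (Fin n → ℝ) → ℝ≥0∞) : ℝ≥0∞ :=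
  (volume Q.toSet)⁻¹ * ∫⁻ x in Q.toSet, F x

/-- `⟨|g|⟩_{Q,s} = (|Q|⁻¹ ∫_Q |g|^s)^{1/s}`. -/
def powerMean (s : ℝ) (Q : Cube n) (g : (Fin n → ℝ) → 𝕜) : ℝ≥0∞ :=
  cubeMean Q (fun x => ‖g x‖ₑ ^ s) ^ (1 / s)

/-- The Luxemburg norm `‖f‖_{L(log L)^β, Q}`, the infimum of the `t > 0` with
`|Q|⁻¹ ∫_Q (|f|/t) log^β(e + |f|/t) ≤ 1`. For `β = 0` it is the mean of `|f|` over `Q`. -/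
def lLogLNorm (β : ℝ) (Q : Cube n) (f : (Fin n → ℝ) → 𝕜) : ℝ≥0∞ :=
  ⨅ (t : ℝ) (_ : 0 < t)
    (_ : cubeMean Q (fun x => ENNReal.ofReal
      (‖f x‖ / t * Real.log (Real.exp 1 + ‖f x‖ / t) ^ β)) ≤ 1),
    ENNReal.ofReal t

/-- `η`-sparse families of cubes. -/
def IsSparse (η : ℝ) (S : Set (Cube n)) : Prop :=
  ∃ E : Cube n → Set (Fin n → ℝ),
    (∀ Q ∈ S, MeasurableSet (E Q) ∧ E Q ⊆ Q.toSet ∧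
      ENNReal.ofReal η * volume Q.toSet ≤ volume (E Q)) ∧
    S.PairwiseDisjoint E

/-- The sparse form `𝓐_{S; L(log L)^β, L^s}(f, g) = ∑_{Q ∈ S} |Q| ‖f‖_{L(log L)^β,Q} ⟨|g|⟩_{Q,s}`.
The case `β = 0` is the form `𝓐_{S; L¹, L^s}`. -/
def sparseForm (S : Set (Cube n)) (β s : ℝ) (f g : (Fin n → ℝ) → 𝕜) : ℝ≥0∞ :=
  ∑' Q : S, volume (Q : Cube n).toSet * lLogLNorm β (Q : Cube n) f * powerMean s (Q : Cube n) g

/-- The `BMO` seminorm, `sup_Q |Q|⁻¹ ∫_Q |b - ⟨b⟩_Q|`. -/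
def bmoNorm (b : (Fin n → ℝ) → 𝕜) : ℝ≥0∞ :=
  ⨆ Q : Cube n, cubeMean Q fun x => ‖b x - ⨍ y in Q.toSet, b y‖ₑ

/-- Membership in `BMO(ℝⁿ)`. -/
structure IsBMO (b : (Fin n → ℝ) → 𝕜) : Prop where
  locallyIntegrable : LocallyIntegrable b volume
  bmoNorm_lt_top : bmoNorm b < ∞

/-- (Essentially) bounded measurable functions with compact support. -/
structure IsBddCompactSupp (f : (Fin n → ℝ) → 𝕜) : Prop where
  memLp_top : MemLp f ∞ volume
  hasCompactSupport : HasCompactSupport f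

/-- Membership in `L^s_loc(ℝⁿ)`. -/
def IsLocLp (s : ℝ) (g : (Fin n → ℝ) → 𝕜) : Prop :=
  ∀ K : Set (Fin n → ℝ), IsCompact K → MemLp g (ENNReal.ofReal s) (volume.restrict K)

/-- `L¹(ℝⁿ)`. -/
abbrev L1 (n : ℕ) (𝕜 : Type*) [RCLike 𝕜] : Type _ :=
  Lp 𝕜 1 (volume : Measure (Fin n → ℝ))

/-- A linear operator that sends `L¹(ℝⁿ)` to (classes of) measurable functions. -/
abbrev Operator (n : ℕ) (𝕜 : Type*) [RCLike 𝕜] : Type _ :=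
  L1 n 𝕜 →ₗ[𝕜] ((Fin n → ℝ) →ₘ[volume] 𝕜)

/-- The weak `L¹` quasinorm `sup_{t > 0} t |{F > t}|` of a nonnegative function. -/
def weakL1Norm (F : (Fin n → ℝ) → ℝ≥0∞) : ℝ≥0∞ :=
  ⨆ t : ℝ≥0, (t : ℝ≥0∞) * volume {x | (t : ℝ≥0∞) < F x}

/-- `f ↦ F f` is bounded from `L¹` to `L^{1,∞}` with bound `A`; here `F f` stands for the modulus
of the image of `f`. -/
def IsWeakType (F : L1 n 𝕜 → (Fin n → ℝ) → ℝ≥0∞) (A : ℝ≥0∞) : Prop :=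
  ∀ f : L1 n 𝕜, weakL1Norm (F f) ≤ A * ‖f‖ₑ

/-- The class of `f χ_{ℝⁿ \ 3Q}`. -/
def awayFrom (Q : Cube n) (f : L1 n 𝕜) : L1 n 𝕜 :=
  ((Lp.memLp f).indicator Q.triple.measurableSet_toSet.compl).toLp _

/-- Lerner's maximal operator
`𝓜_{p,T} f(x) = sup_{Q ∋ x} (|Q|⁻¹ ∫_Q |T(f χ_{ℝⁿ \ 3Q})|^p)^{1/p}`. -/
def lernerMaximal (p : ℝ) (T : Operator n 𝕜) (f : L1 n 𝕜) (x : Fin n → ℝ) : ℝ≥0∞ :=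
  ⨆ (Q : Cube n) (_ : x ∈ Q.toSet), powerMean p Q (T (awayFrom Q f))

theorem IsBddCompactSupp.memLp_mul {f b : (Fin n → ℝ) → 𝕜} (hf : IsBddCompactSupp f)
    (hb : LocallyIntegrable b volume) : MemLp (fun x => b x * f x) 1 volume := by
  have hK : IsCompact (tsupport f) := hf.hasCompactSupport
  have h1 : MemLp b 1 (volume.restrict (tsupport f)) :=
    memLp_one_iff_integrable.2 (hb.integrableOn_isCompact hK)
  have h2 : MemLp (fun x => b x * f x) 1 (volume.restrict (tsupport f)) :=
    (hf.memLp_top.restrict _).mul h1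
  have h3 := (memLp_indicator_iff_restrict (isClosed_tsupport f).measurableSet).2 h2
  have h4 : (tsupport f).indicator (fun x => b x * f x) = fun x => b x * f x := by
    rw [Set.indicator_eq_self]
    intro x hx
    refine subset_tsupport f fun h0 => hx ?_
    simp only [h0, mul_zero]
  rwa [h4] at h3

theorem IsBddCompactSupp.memLp_one {f : (Fin n → ℝ) → 𝕜} (hf : IsBddCompactSupp f) :
    MemLp f 1 volume := by
  simpa using hf.memLp_mul (locallyIntegrable_const (1 : 𝕜))

/-- The commutator `T_b f = b · T f - T (b f)`, for bounded `f` with compact support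
and `b ∈ BMO` (so that `f` and `b f` are in `L¹`). -/
def symbolCommutator (T : Operator n 𝕜) {b f : (Fin n → ℝ) → 𝕜} (hb : IsBMO b)
    (hf : IsBddCompactSupp f) (x : Fin n → ℝ) : 𝕜 :=
  b x * T (hf.memLp_one.toLp f) x - T ((hf.memLp_mul hb.locallyIntegrable).toLp _) x

end SparseCommutator

end

open SparseCommutator

open MeasureTheory
open scoped ENNReal NNReal

noncomputable section

namespace SparseCommutator

variable {n : ℕ} {𝕜 : Type*} [RCLike 𝕜]

/-! ### Cubes, their threefold dilates and their measure. -/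

namespace Cube

/-! The operator is localized by a stopping-time selection of cubes. Split `ℝⁿ` into root cubes `Q`
with `supp f ⊆ 3Q`. On a root, `T_b f` equals `w_Q = χ_Q (b T(f χ_{3Q}) - T(b f χ_{3Q}))`. For every
cube `Q`, choose disjoint subcubes `P` of total measure at most `|Q|/2` and telescope: the sum of
`w_Q - ∑_P w_P` over all cubes produced from the roots is the sum of `w_Q` over the roots, that is,
`T_b f` almost everywhere.

A commutator does not change when a constant is subtracted from `b`. With `β` the mean of `b` over
`3Q` and `R F = T F - ∑_P χ_P T(F χ_{3P})`, this gives on `Q` that `w_Q - ∑_P w_P = (b - β) R(f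
χ_{3Q}) - R((b - β) f χ_{3Q})` (`residual_sub_residual_ae_eq`). The two terms, summed over all
cubes, are `H₁` and `H₂`.

The subcubes come from a Calderón–Zygmund decomposition of the set where `|T F|` or the maximal
function of `F` exceeds a multiple of `‖F‖₁ / |Q|`, for both functions `F` at once
(`exists_stoppingCubes`). The weak type bounds make this set small. Off the subcubes `R F = T F` is
bounded; on a subcube `P`, `R F = T(F χ_{ℝⁿ \ 3P})`, whose `L^{p₀}` mean over `P` is at most the
maximal function at any point of `P`, in particular at a good one. So the `L^{p₀}` mean of `R F`
over `Q` is at most a constant times `‖F‖₁ / |Q|`.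

Hölder's inequality against `g` then gives the two forms. For `H₁`, the factor `b - β` goes to `g`,
and its `L^{r'p₀'}` mean is at most a multiple of `r'p₀' ‖b‖_BMO` by John–Nirenberg
(`powerMean_oscillation_le`). For `H₂`, it stays with `f`, and the duality of `L log L` and the
exponential class applies (`cubeMean_oscillation_mul_le`). The dilates `3Q` are sparse because each
`Q` keeps half of its measure outside its subcubes. -/

theorem mem_toSet {Q : Cube n} {x : Fin n → ℝ} :
    x ∈ Q.toSet ↔ ∀ i, Q.corner i ≤ x i ∧ x i < Q.corner i + Q.side := by
  simp [toSet, Set.mem_pi]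

theorem volume_toSet (Q : Cube n) : volume Q.toSet = ENNReal.ofReal Q.side ^ n := by
  simp [toSet, Real.volume_pi_Ico]

theorem volume_toSet_ne_zero (Q : Cube n) : volume Q.toSet ≠ 0 := by
  rw [volume_toSet]
  exact pow_ne_zero _ (by simpa using Q.side_pos)

theorem volume_toSet_ne_top (Q : Cube n) : volume Q.toSet ≠ ∞ := by
  rw [volume_toSet]
  exact ENNReal.pow_ne_top ENNReal.ofReal_ne_top

theorem volume_mul_cubeMean (Q : Cube n) (F : (Fin n → ℝ) → ℝ≥0∞) :
    volume Q.toSet * cubeMean Q F = ∫⁻ x in Q.toSet, F x := by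
  rw [cubeMean, ← mul_assoc, ENNReal.mul_inv_cancel Q.volume_toSet_ne_zero Q.volume_toSet_ne_top,
    one_mul]

theorem cubeMean_le_iff (Q : Cube n) (F : (Fin n → ℝ) → ℝ≥0∞) (a : ℝ≥0∞) :
    cubeMean Q F ≤ a ↔ ∫⁻ x in Q.toSet, F x ≤ volume Q.toSet * a := by
  rw [← volume_mul_cubeMean Q F,
    ENNReal.mul_le_mul_iff_right Q.volume_toSet_ne_zero Q.volume_toSet_ne_top]

theorem lt_cubeMean_iff (Q : Cube n) (F : (Fin n → ℝ) → ℝ≥0∞) (a : ℝ≥0∞) :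
    a < cubeMean Q F ↔ volume Q.toSet * a < ∫⁻ x in Q.toSet, F x := by
  rw [← not_le, ← not_le, cubeMean_le_iff]

/-- Cubes are balls of the supremum norm up to a null set, which makes the differentiation theorem
for doubling measures applicable to them. -/
theorem toSet_ae_eq_closedBall (Q : Cube n) :
    Q.toSet =ᵐ[volume] Metric.closedBall (fun i => Q.corner i + Q.side / 2) (Q.side / 2) := by
  rw [closedBall_pi _ (by linarith [Q.side_pos])]
  simp only [Real.closedBall_eq_Icc]
  rw [Set.pi_univ_Icc]
  have h := Measure.univ_pi_Ico_ae_eq_Icc (μ := fun _ : Fin n => (volume : Measure ℝ))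
    (f := Q.corner) (g := fun i => Q.corner i + Q.side)
  have h1 : (fun i => Q.corner i + Q.side / 2 - Q.side / 2) = Q.corner := by ext i; ring
  have h2 : (fun i => Q.corner i + Q.side / 2 + Q.side / 2) = fun i => Q.corner i + Q.side := by
    ext i; ring
  rw [h1, h2]
  exact h

theorem toSet_subset_closedBall (Q : Cube n) :
    Q.toSet ⊆ Metric.closedBall (fun i => Q.corner i + Q.side / 2) (Q.side / 2) := by
  intro x hx
  rw [closedBall_pi _ (by linarith [Q.side_pos])]
  simp only [Real.closedBall_eq_Icc, Set.mem_pi, Set.mem_Icc]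
  intro i _
  have := mem_toSet.1 hx i
  constructor <;> linarith

theorem integrableOn_toSet {F : Type*} [NormedAddCommGroup F] {h : (Fin n → ℝ) → F}
    (hh : LocallyIntegrable h volume) (Q : Cube n) : IntegrableOn h Q.toSet volume :=
  (hh.integrableOn_isCompact (isCompact_closedBall _ _)).mono_set Q.toSet_subset_closedBall

theorem toSet_subset_iff {P Q : Cube n} :
    P.toSet ⊆ Q.toSet ↔ ∀ i, Q.corner i ≤ P.corner i ∧
      P.corner i + P.side ≤ Q.corner i + Q.side := by
  have hP : ∀ i, P.corner i < P.corner i + P.side := fun i => by linarith [P.side_pos]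
  unfold toSet
  rw [Set.univ_pi_subset_univ_pi_iff]
  constructor
  · rintro (h | ⟨i, hi⟩)
    · intro i
      exact (Set.Ico_subset_Ico_iff (hP i)).1 (h i)
    · exact absurd hi (Set.nonempty_Ico.2 (hP i)).ne_empty
  · intro h
    exact Or.inl fun i => Set.Ico_subset_Ico (h i).1 (h i).2

theorem triple_side (Q : Cube n) : Q.triple.side = 3 * Q.side := rfl

theorem triple_corner (Q : Cube n) (i : Fin n) : Q.triple.corner i = Q.corner i - Q.side := by
  simp only [triple, dilate]; ring

theorem triple_subset_triple {P Q : Cube n} (h : P.toSet ⊆ Q.toSet) :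
    P.triple.toSet ⊆ Q.triple.toSet := by
  rw [toSet_subset_iff] at h ⊢
  intro i
  have := h i
  simp only [triple_corner, triple_side]
  constructor <;> linarith

theorem toSet_subset_triple (Q : Cube n) : Q.toSet ⊆ Q.triple.toSet := by
  rw [toSet_subset_iff]
  intro i
  have := Q.side_pos
  simp only [triple_corner, triple_side]
  constructor <;> linarith

theorem volume_triple (Q : Cube n) : volume Q.triple.toSet = 3 ^ n * volume Q.toSet := by
  rw [volume_toSet, volume_toSet, triple_side, ENNReal.ofReal_mul (by norm_num), mul_pow]
  norm_num

theorem ext' {P Q : Cube n} (h : ∀ i, P.corner i = Q.corner i) (h' : P.side = Q.side) : P = Q := by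
  cases P; cases Q
  simp only [mk.injEq]
  exact ⟨funext h, h'⟩

theorem triple_injective : Function.Injective (triple : Cube n → Cube n) := by
  intro P Q h
  have hs : P.side = Q.side := by
    have := congrArg side h
    simp only [triple_side] at this
    linarith
  refine ext' (fun i => ?_) hs
  have := congrArg (fun R => corner R i) h
  simp only [triple_corner] at this
  linarith

end Cube

/-! ### Grids, dyadic subcubes and the Calderón–Zygmund decomposition. -/

/-- The cube of side length `s` that contains `x`, in the grid with a vertex at `c`. -/
def gridCell (c : Fin n → ℝ) (s : ℝ) (hs : 0 < s) (x : Fin n → ℝ) : Cube n where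
  corner := fun i => c i + s * ⌊(x i - c i) / s⌋
  side := s
  side_pos := hs

theorem mem_gridCell {c : Fin n → ℝ} {s : ℝ} {hs : 0 < s} {x y : Fin n → ℝ} :
    y ∈ (gridCell c s hs x).toSet ↔ ∀ i, ⌊(y i - c i) / s⌋ = ⌊(x i - c i) / s⌋ := by
  rw [Cube.mem_toSet]
  refine forall_congr' fun i => ?_
  rw [Int.floor_eq_iff, le_div_iff₀ hs, div_lt_iff₀ hs]
  simp only [gridCell]
  constructor <;> rintro ⟨h1, h2⟩ <;> constructor <;> linarith

theorem self_mem_gridCell (c : Fin n → ℝ) (s : ℝ) (hs : 0 < s) (x : Fin n → ℝ) :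
    x ∈ (gridCell c s hs x).toSet := mem_gridCell.2 fun _ => rfl

theorem gridCell_eq_of_mem {c : Fin n → ℝ} {s : ℝ} {hs : 0 < s} {x y : Fin n → ℝ}
    (h : y ∈ (gridCell c s hs x).toSet) : gridCell c s hs y = gridCell c s hs x := by
  rw [mem_gridCell] at h
  refine Cube.ext' (fun i => ?_) rfl
  simp only [gridCell, h i]

theorem countable_range_gridCell (c : Fin n → ℝ) (s : ℝ) (hs : 0 < s) :
    (Set.range (gridCell c s hs)).Countable := by
  refine (Set.countable_range fun m : Fin n → ℤ =>
    (⟨fun i => c i + s * (m i : ℝ), s, hs⟩ : Cube n)).mono ?_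
  rintro _ ⟨x, rfl⟩
  exact ⟨fun i => ⌊(x i - c i) / s⌋, rfl⟩

/-- The dyadic subcube of `Q` of generation `k` that contains `x`. -/
def dyadicCell (Q : Cube n) (k : ℕ) (x : Fin n → ℝ) : Cube n :=
  gridCell Q.corner (Q.side / 2 ^ k) (div_pos Q.side_pos (by positivity)) x

theorem self_mem_dyadicCell (Q : Cube n) (k : ℕ) (x : Fin n → ℝ) :
    x ∈ (dyadicCell Q k x).toSet := self_mem_gridCell _ _ _ x

theorem dyadicCell_eq_of_mem {Q : Cube n} {k : ℕ} {x y : Fin n → ℝ}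
    (h : y ∈ (dyadicCell Q k x).toSet) : dyadicCell Q k y = dyadicCell Q k x :=
  gridCell_eq_of_mem h

theorem dyadicCell_zero {Q : Cube n} {x : Fin n → ℝ} (hx : x ∈ Q.toSet) : dyadicCell Q 0 x = Q := by
  have hs := Q.side_pos
  refine Cube.ext' (fun i => ?_) (by simp [dyadicCell, gridCell])
  have hxi := Cube.mem_toSet.1 hx i
  have : ⌊(x i - Q.corner i) / Q.side⌋ = 0 := by
    rw [Int.floor_eq_iff, le_div_iff₀ hs, div_lt_iff₀ hs]
    norm_num
    constructor <;> linarith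
  simp [dyadicCell, gridCell, this]

theorem dyadicCell_succ_subset (Q : Cube n) (k : ℕ) (x : Fin n → ℝ) :
    (dyadicCell Q (k + 1) x).toSet ⊆ (dyadicCell Q k x).toSet := by
  intro y hy
  have hs := Q.side_pos
  unfold dyadicCell at hy ⊢
  rw [mem_gridCell] at hy ⊢
  intro i
  -- Nesting of the generations: `⌊z / 2⌋` depends only on `⌊z⌋`.
  have key : ∀ z : ℝ, z / (Q.side / 2 ^ k) = (z / (Q.side / 2 ^ (k + 1))) / ((2 : ℕ) : ℝ) := by
    intro z
    push_cast
    field_simp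
    ring
  rw [key, key, Int.floor_div_natCast, Int.floor_div_natCast, hy i]

theorem dyadicCell_antitone (Q : Cube n) (x : Fin n → ℝ) {j k : ℕ} (h : j ≤ k) :
    (dyadicCell Q k x).toSet ⊆ (dyadicCell Q j x).toSet :=
  antitone_nat_of_succ_le (f := fun k => (dyadicCell Q k x).toSet)
    (fun k => dyadicCell_succ_subset Q k x) h

theorem volume_dyadicCell_succ (Q : Cube n) (k : ℕ) (x : Fin n → ℝ) :
    volume (dyadicCell Q k x).toSet = 2 ^ n * volume (dyadicCell Q (k + 1) x).toSet := by
  rw [Cube.volume_toSet, Cube.volume_toSet]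
  have : (dyadicCell Q k x).side = 2 * (dyadicCell Q (k + 1) x).side := by
    simp only [dyadicCell, gridCell]
    field_simp
    ring
  rw [this, ENNReal.ofReal_mul (by norm_num), mul_pow]
  norm_num

/-- Lebesgue differentiation along dyadic subcubes. -/
theorem ae_tendsto_cubeMean_dyadicCell {F : Type*} [NormedAddCommGroup F]
    {h : (Fin n → ℝ) → F} (hh : LocallyIntegrable h volume) (Q : Cube n) :
    ∀ᵐ x, Filter.Tendsto (fun k => cubeMean (dyadicCell Q k x) fun y => ‖h y‖ₑ) Filter.atTop
      (nhds ‖h x‖ₑ) := by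
  have hn : LocallyIntegrable (fun x => ‖h x‖) volume := fun x => (hh x).norm
  filter_upwards [IsUnifLocDoublingMeasure.ae_tendsto_average volume hn 1] with x hx
  have hside : Filter.Tendsto (fun k : ℕ => Q.side / 2 ^ k / 2) Filter.atTop
      (nhdsWithin 0 (Set.Ioi 0)) := by
    refine tendsto_nhdsWithin_iff.2 ⟨?_, Filter.Eventually.of_forall fun k => ?_⟩
    · have h1 : Filter.Tendsto (fun k : ℕ => Q.side / 2 * (1 / 2 : ℝ) ^ k) Filter.atTop
          (nhds (Q.side / 2 * 0)) :=
        (tendsto_pow_atTop_nhds_zero_of_lt_one (by norm_num) (by norm_num)).const_mul _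
      rw [mul_zero] at h1
      refine h1.congr fun k => ?_
      rw [one_div, inv_pow]
      ring
    · have := Q.side_pos
      simp only [Set.mem_Ioi]
      positivity
  have h1 := hx (fun k i => (dyadicCell Q k x).corner i + (dyadicCell Q k x).side / 2)
    (fun k => (dyadicCell Q k x).side / 2) hside
    (Filter.Eventually.of_forall fun k => by
      rw [one_mul]
      exact Cube.toSet_subset_closedBall _ (self_mem_dyadicCell Q k x))
  have h2 := (ENNReal.continuous_ofReal.tendsto _).comp h1
  rw [ofReal_norm] at h2
  refine h2.congr fun k => ?_
  simp only [Function.comp]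
  rw [← setAverage_congr (Cube.toSet_ae_eq_closedBall (dyadicCell Q k x)),
    ofReal_setAverage (Cube.integrableOn_toSet hn _)
      (Filter.Eventually.of_forall fun y => norm_nonneg _),
    cubeMean, ENNReal.div_eq_inv_mul]
  simp only [ofReal_norm]

/-- The Calderón–Zygmund decomposition of `h` on the cube `Q` at height `α`. -/
theorem exists_calderonZygmund {F : Type*} [NormedAddCommGroup F]
    (Q : Cube n) {h : (Fin n → ℝ) → F} (hh : LocallyIntegrable h volume) {α : ℝ≥0∞}
    (hα : α ≠ 0) (hα' : α ≠ ∞) (hQ : cubeMean Q (fun x => ‖h x‖ₑ) ≤ α) :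
    ∃ C : Set (Cube n), C.Countable ∧ C.PairwiseDisjoint Cube.toSet ∧
      (∀ P ∈ C, P.toSet ⊆ Q.toSet) ∧
      (∀ P ∈ C, cubeMean P (fun x => ‖h x‖ₑ) ≤ 2 ^ n * α) ∧
      ∑' P : C, volume (P : Cube n).toSet ≤ α⁻¹ * ∫⁻ x in Q.toSet, ‖h x‖ₑ ∧
      ∀ᵐ x, x ∈ Q.toSet → x ∉ ⋃ P ∈ C, P.toSet → ‖h x‖ₑ ≤ α := by
  classical
  set m : Cube n → ℝ≥0∞ := fun P => cubeMean P fun x => ‖h x‖ₑ with hm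
  -- The maximal dyadic subcubes with mean above `α`: along the chain through a point, the first
  -- such cube is taken.
  set C : Set (Cube n) := {P | ∃ x ∈ Q.toSet, ∃ k, P = dyadicCell Q k x ∧ α < m (dyadicCell Q k x) ∧
    ∀ j < k, m (dyadicCell Q j x) ≤ α} with hC
  have hsub : ∀ P ∈ C, P.toSet ⊆ Q.toSet := by
    rintro P ⟨x, hx, k, rfl, -, -⟩
    have := dyadicCell_antitone Q x (Nat.zero_le k)
    rwa [dyadicCell_zero hx] at this
  have hcount : C.Countable := by
    refine (Set.countable_iUnion fun k : ℕ => countable_range_gridCell Q.corner (Q.side / 2 ^ k)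
      (div_pos Q.side_pos (by positivity))).mono ?_
    rintro P ⟨x, hx, k, rfl, -, -⟩
    exact Set.mem_iUnion.2 ⟨k, x, rfl⟩
  have hrep : ∀ P ∈ C, ∀ y ∈ P.toSet, ∃ k, P = dyadicCell Q k y ∧ α < m (dyadicCell Q k y) ∧
      ∀ j < k, m (dyadicCell Q j y) ≤ α := by
    rintro P ⟨x, hx, k, rfl, h1, h2⟩ y hy
    have hj : ∀ j ≤ k, dyadicCell Q j y = dyadicCell Q j x := fun j hj =>
      dyadicCell_eq_of_mem (dyadicCell_antitone Q x hj hy)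
    refine ⟨k, (hj k le_rfl).symm, ?_, fun j hjk => ?_⟩
    · rwa [hj k le_rfl]
    · rw [hj j hjk.le]; exact h2 j hjk
  have hdisj : C.PairwiseDisjoint Cube.toSet := by
    intro P hP P' hP' hne
    refine Set.disjoint_left.2 fun y hy hy' => hne ?_
    obtain ⟨k, rfl, h1, h2⟩ := hrep P hP y hy
    obtain ⟨k', rfl, h1', h2'⟩ := hrep P' hP' y hy'
    rcases lt_trichotomy k k' with hk | rfl | hk
    · exact absurd (h2' k hk) (not_le.2 h1)
    · rfl
    · exact absurd (h2 k' hk) (not_le.2 h1')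
  refine ⟨C, hcount, hdisj, hsub, ?_, ?_, ?_⟩
  · rintro P ⟨x, hx, k, rfl, h1, h2⟩
    -- Generation `0` is never selected because of `hQ`, so a selected cube has a dyadic parent,
    -- whose mean is at most `α`; this costs the factor `2 ^ n`.
    cases k with
    | zero =>
      rw [dyadicCell_zero hx] at h1
      exact absurd hQ (not_le.2 h1)
    | succ k =>
      have h3 := h2 k (Nat.lt_succ_self k)
      rw [hm, Cube.cubeMean_le_iff] at h3
      rw [Cube.cubeMean_le_iff]
      refine (lintegral_mono_set (dyadicCell_succ_subset Q k x)).trans (h3.trans ?_)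
      rw [volume_dyadicCell_succ]
      exact le_of_eq (by ring)
  · have h1 : ∀ P : C, volume (P : Cube n).toSet ≤ α⁻¹ * ∫⁻ x in (P : Cube n).toSet, ‖h x‖ₑ := by
      rintro ⟨P, x, hx, k, rfl, h1, h2⟩
      rw [hm, Cube.lt_cubeMean_iff] at h1
      rw [← ENNReal.div_eq_inv_mul, ENNReal.le_div_iff_mul_le (Or.inl hα) (Or.inl hα')]
      exact h1.le
    refine (ENNReal.tsum_le_tsum h1).trans ?_
    rw [ENNReal.tsum_mul_left, ← lintegral_biUnion hcount
      (fun P _ => P.measurableSet_toSet) hdisj]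
    gcongr
    exact Set.iUnion₂_subset hsub
  · filter_upwards [ae_tendsto_cubeMean_dyadicCell hh Q] with x hx hxQ hxC
    refine le_of_tendsto' hx fun k => ?_
    by_contra hk
    have hex : ∃ k, α < m (dyadicCell Q k x) := ⟨k, not_le.1 hk⟩
    refine hxC (Set.mem_iUnion₂.2 ⟨dyadicCell Q (Nat.find hex) x,
      ⟨x, hxQ, Nat.find hex, rfl, Nat.find_spec hex, fun j hj => ?_⟩, self_mem_dyadicCell _ _ _⟩)
    exact not_lt.1 (Nat.find_min hex hj)

/-! ### Functions of bounded mean oscillation: John–Nirenberg and its consequences. -/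

theorem cubeMean_oscillation_le_bmoNorm (b : (Fin n → ℝ) → 𝕜) (Q : Cube n) :
    cubeMean Q (fun x => ‖b x - ⨍ y in Q.toSet, b y‖ₑ) ≤ bmoNorm b :=
  le_iSup (fun Q : Cube n => cubeMean Q fun x => ‖b x - ⨍ y in Q.toSet, b y‖ₑ) Q

theorem enorm_average_sub_le_cubeMean {b : (Fin n → ℝ) → 𝕜} (hb : LocallyIntegrable b volume)
    (P : Cube n) (a : 𝕜) :
    ‖(⨍ y in P.toSet, b y) - a‖ₑ ≤ cubeMean P fun x => ‖b x - a‖ₑ := by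
  have h0 : volume.real P.toSet ≠ 0 :=
    (ENNReal.toReal_ne_zero.2 ⟨P.volume_toSet_ne_zero, P.volume_toSet_ne_top⟩)
  have hfin : IsFiniteMeasure (volume.restrict P.toSet) :=
    ⟨by simpa using P.volume_toSet_ne_top.lt_top⟩
  have h1 : (⨍ y in P.toSet, b y) - a = (volume.real P.toSet)⁻¹ • ∫ y in P.toSet, (b y - a) := by
    rw [integral_sub (P.integrableOn_toSet hb) (integrable_const a), setAverage_eq, smul_sub,
      setIntegral_const, smul_smul, inv_mul_cancel₀ h0, one_smul]
  rw [h1, enorm_smul, cubeMean]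
  have h2 : ‖(volume.real P.toSet)⁻¹‖ₑ = (volume P.toSet)⁻¹ := by
    rw [Real.enorm_eq_ofReal (by positivity), ENNReal.ofReal_inv_of_pos (by positivity),
      Measure.real, ENNReal.ofReal_toReal P.volume_toSet_ne_top]
  rw [h2]
  gcongr
  exact enorm_integral_le_lintegral_enorm _

/-- The John–Nirenberg inequality for distribution functions. -/
theorem volume_oscillation_gt_le {b : (Fin n → ℝ) → 𝕜} (hb : LocallyIntegrable b volume) {B : ℝ}
    (hB : 0 < B) (hbB : bmoNorm b ≤ ENNReal.ofReal B) (k : ℕ) (Q : Cube n) :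
    volume ({x | (k : ℝ) * (2 ^ (n + 1) * B) < ‖b x - ⨍ y in Q.toSet, b y‖} ∩ Q.toSet) ≤
      2⁻¹ ^ k * volume Q.toSet := by
  induction k generalizing Q with
  | zero => simpa using measure_mono Set.inter_subset_right
  | succ k ih =>
    set a : 𝕜 := ⨍ y in Q.toSet, b y with ha
    have hα : ENNReal.ofReal (2 * B) ≠ 0 := by simpa using hB
    have hmean : cubeMean Q (fun x => ‖b x - a‖ₑ) ≤ ENNReal.ofReal B :=
      (cubeMean_oscillation_le_bmoNorm b Q).trans hbB
    have hmean2 : cubeMean Q (fun x => ‖b x - a‖ₑ) ≤ ENNReal.ofReal (2 * B) :=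
      hmean.trans (ENNReal.ofReal_le_ofReal (by linarith))
    -- The height `2B` is twice the bound for the mean, so the selected cubes fill at most half of
    -- `Q`. Passing to a selected cube moves the average by at most `2 ^ n * (2 * B)`, which is
    -- exactly one step of the threshold.
    obtain ⟨C, hCc, hCd, hCs, hCm, hCv, hCa⟩ := exists_calderonZygmund Q
      (h := fun x => b x - a) (hb.sub (locallyIntegrable_const a)) hα ENNReal.ofReal_ne_top hmean2
    have hD : ENNReal.ofReal (2 ^ (n + 1) * B) = 2 ^ n * ENNReal.ofReal (2 * B) := by
      rw [pow_succ, mul_assoc, ENNReal.ofReal_mul (by positivity),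
        ENNReal.ofReal_pow (by norm_num)]
      norm_num
    have h2D : 2 * B ≤ 2 ^ (n + 1) * B := by
      have : (1 : ℝ) ≤ 2 ^ n := one_le_pow₀ (by norm_num)
      rw [pow_succ]
      nlinarith
    have hosc : ∀ P ∈ C, ‖(⨍ y in P.toSet, b y) - a‖ ≤ 2 ^ (n + 1) * B := by
      intro P hP
      have := (enorm_average_sub_le_cubeMean hb P a).trans (hCm P hP)
      rw [← hD, ← ofReal_norm, ENNReal.ofReal_le_ofReal_iff (by positivity)] at this
      exact this
    have hsum : ∑' P : C, volume (P : Cube n).toSet ≤ 2⁻¹ * volume Q.toSet := by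
      refine hCv.trans ?_
      rw [Cube.cubeMean_le_iff] at hmean
      refine (mul_le_mul_right hmean _).trans (le_of_eq ?_)
      rw [ENNReal.ofReal_mul (by norm_num), ENNReal.ofReal_ofNat,
        ENNReal.mul_inv (by simp) (by simp)]
      have h3 : (ENNReal.ofReal B)⁻¹ * ENNReal.ofReal B = 1 :=
        ENNReal.inv_mul_cancel (by simpa using hB) ENNReal.ofReal_ne_top
      calc 2⁻¹ * (ENNReal.ofReal B)⁻¹ * (volume Q.toSet * ENNReal.ofReal B)
          = 2⁻¹ * volume Q.toSet * ((ENNReal.ofReal B)⁻¹ * ENNReal.ofReal B) := by ring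
        _ = _ := by rw [h3, mul_one]
    calc volume ({x | ((k + 1 : ℕ) : ℝ) * (2 ^ (n + 1) * B) < ‖b x - a‖} ∩ Q.toSet)
        ≤ volume (⋃ P ∈ C, {x | (k : ℝ) * (2 ^ (n + 1) * B) < ‖b x - ⨍ y in P.toSet, b y‖} ∩
            P.toSet) := by
          refine measure_mono_ae ?_
          filter_upwards [hCa] with x hx hxS
          obtain ⟨hx1, hxQ⟩ := hxS
          simp only [Set.mem_ofPred_eq] at hx1
          push_cast at hx1
          have hxC : x ∈ ⋃ P ∈ C, P.toSet := by
            by_contra hxC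
            have h4 := hx hxQ hxC
            rw [← ofReal_norm, ENNReal.ofReal_le_ofReal_iff (by positivity)] at h4
            have h5 : 0 ≤ (k : ℝ) * (2 ^ (n + 1) * B) := by positivity
            linarith
          obtain ⟨P, hP, hxP⟩ := Set.mem_iUnion₂.1 hxC
          refine Set.mem_iUnion₂.2 ⟨P, hP, ?_, hxP⟩
          have h6 := hosc P hP
          have h7 := norm_sub_le_norm_sub_add_norm_sub (b x) (⨍ y in P.toSet, b y) a
          simp only [Set.mem_ofPred_eq]
          linarith
      _ ≤ ∑' P : C, volume ({x | (k : ℝ) * (2 ^ (n + 1) * B) <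
            ‖b x - ⨍ y in (P : Cube n).toSet, b y‖} ∩ (P : Cube n).toSet) :=
          measure_biUnion_le _ hCc _
      _ ≤ ∑' P : C, 2⁻¹ ^ k * volume (P : Cube n).toSet :=
          ENNReal.tsum_le_tsum fun P => ih P
      _ = 2⁻¹ ^ k * ∑' P : C, volume (P : Cube n).toSet := ENNReal.tsum_mul_left
      _ ≤ 2⁻¹ ^ k * (2⁻¹ * volume Q.toSet) := by gcongr
      _ = 2⁻¹ ^ (k + 1) * volume Q.toSet := by ring

/-- For `v > 0` the single term with `k < v ≤ k + 1` already dominates. The base `3/2` is less than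
`2`, so that the series still converges against the decay `2⁻¹ ^ k` of the distribution function. -/
theorem ofReal_exp_le_one_add_tsum {v : ℝ} (hv : 0 ≤ v) :
    ENNReal.ofReal (Real.exp (Real.log (3 / 2) * v)) ≤
      1 + ∑' k : ℕ, if (k : ℝ) < v then ENNReal.ofReal (3 / 2) ^ (k + 1) else 0 := by
  rcases hv.eq_or_lt with rfl | hv
  · simp
  · have hc : 0 < Real.log (3 / 2) := Real.log_pos (by norm_num)
    obtain ⟨k, hk⟩ : ∃ k, ⌈v⌉₊ = k + 1 :=
      Nat.exists_eq_succ_of_ne_zero (Nat.ceil_pos.2 hv).ne'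
    have h1 : v ≤ k + 1 := by
      have := Nat.le_ceil v
      rw [hk] at this
      exact_mod_cast this
    have h2 : (k : ℝ) < v := Nat.lt_ceil.1 (by omega)
    refine le_trans ?_ le_add_self
    refine le_trans ?_ (ENNReal.le_tsum k)
    rw [if_pos h2, ← ENNReal.ofReal_pow (by norm_num)]
    refine ENNReal.ofReal_le_ofReal ?_
    calc Real.exp (Real.log (3 / 2) * v) ≤ Real.exp (((k + 1 : ℕ) : ℝ) * Real.log (3 / 2)) := by
          rw [Real.exp_le_exp, mul_comm]
          push_cast
          gcongr
      _ = (3 / 2) ^ (k + 1) := by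
          rw [Real.exp_nat_mul, Real.exp_log (by norm_num)]

/-- Exponential integrability of functions of bounded mean oscillation. -/
theorem cubeMean_exp_oscillation_le {b : (Fin n → ℝ) → 𝕜} (hb : LocallyIntegrable b volume) {B : ℝ}
    (hB : 0 < B) (hbB : bmoNorm b ≤ ENNReal.ofReal B) (Q : Cube n) :
    cubeMean Q (fun x => ENNReal.ofReal (Real.exp (Real.log (3 / 2) *
      (‖b x - ⨍ y in Q.toSet, b y‖ / (2 ^ (n + 1) * B))))) ≤ 7 := by
  set a : 𝕜 := ⨍ y in Q.toSet, b y with ha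
  have hD : 0 < 2 ^ (n + 1) * B := by positivity
  have hnull : ∀ k : ℕ, NullMeasurableSet {x | (k : ℝ) * (2 ^ (n + 1) * B) < ‖b x - a‖}
      (volume.restrict Q.toSet) := fun k =>
    nullMeasurableSet_lt aemeasurable_const
      ((hb.aestronglyMeasurable.sub aestronglyMeasurable_const).norm.aemeasurable.restrict)
  rw [Cube.cubeMean_le_iff]
  calc ∫⁻ x in Q.toSet, ENNReal.ofReal (Real.exp (Real.log (3 / 2) *
        (‖b x - a‖ / (2 ^ (n + 1) * B))))
      ≤ ∫⁻ x in Q.toSet, (1 + ∑' k : ℕ, {x | (k : ℝ) * (2 ^ (n + 1) * B) < ‖b x - a‖}.indicator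
          (fun _ => ENNReal.ofReal (3 / 2) ^ (k + 1)) x) := by
        refine lintegral_mono fun x => ?_
        refine (ofReal_exp_le_one_add_tsum (by positivity)).trans (le_of_eq ?_)
        congr 1
        refine tsum_congr fun k => ?_
        simp only [Set.indicator_apply, Set.mem_ofPred_eq, lt_div_iff₀ hD]
    _ = volume Q.toSet + ∑' k : ℕ, ∫⁻ x in Q.toSet,
          {x | (k : ℝ) * (2 ^ (n + 1) * B) < ‖b x - a‖}.indicator
          (fun _ => ENNReal.ofReal (3 / 2) ^ (k + 1)) x := by
        rw [lintegral_add_left measurable_const, lintegral_tsum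
          fun k => aemeasurable_const.indicator₀ (hnull k)]
        simp
    _ ≤ volume Q.toSet + ∑' k : ℕ, ENNReal.ofReal (3 / 2) ^ (k + 1) *
          (2⁻¹ ^ k * volume Q.toSet) := by
        gcongr with k
        refine (lintegral_indicator_const_le _ _).trans ?_
        rw [Measure.restrict_apply' Q.measurableSet_toSet]
        gcongr
        exact volume_oscillation_gt_le hb hB hbB k Q
    _ = volume Q.toSet + ENNReal.ofReal (3 / 2) * volume Q.toSet *
          ∑' k : ℕ, ENNReal.ofReal (3 / 4) ^ k := by
        rw [← ENNReal.tsum_mul_left]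
        congr 1
        refine tsum_congr fun k => ?_
        have : ENNReal.ofReal (3 / 4) = ENNReal.ofReal (3 / 2) * 2⁻¹ := by
          rw [← ENNReal.ofReal_ofNat, ← ENNReal.ofReal_inv_of_pos (by norm_num),
            ← ENNReal.ofReal_mul (by norm_num)]
          norm_num
        rw [this]
        ring
    -- The geometric series has sum `4`, and `1 + (3/2) * 4 = 7`.
    _ = volume Q.toSet * 7 := by
        rw [ENNReal.tsum_geometric]
        have : (1 - ENNReal.ofReal (3 / 4))⁻¹ = ENNReal.ofReal 4 := by
          rw [← ENNReal.ofReal_one, ← ENNReal.ofReal_sub _ (by norm_num),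
            ← ENNReal.ofReal_inv_of_pos (by norm_num)]
          norm_num
        rw [this, mul_right_comm, ← ENNReal.ofReal_mul (by norm_num)]
        norm_num
        ring

/-- The degenerate case, set apart because the exponential estimate divides by a positive bound for
the seminorm. -/
theorem ae_eq_average_of_bmoNorm_eq_zero {b : (Fin n → ℝ) → 𝕜}
    (hb : LocallyIntegrable b volume) (h0 : bmoNorm b = 0) (Q : Cube n) :
    ∀ᵐ x ∂volume.restrict Q.toSet, b x - ⨍ y in Q.toSet, b y = 0 := by
  have h1 := cubeMean_oscillation_le_bmoNorm b Q
  rw [h0, Cube.cubeMean_le_iff, mul_zero, nonpos_iff_eq_zero, lintegral_eq_zero_iff'] at h1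
  · filter_upwards [h1] with x hx
    simpa using hx
  · exact (hb.aestronglyMeasurable.sub aestronglyMeasurable_const).enorm.restrict

/-- The dimensional constant of the John–Nirenberg inequality. -/
def johnNirenbergConst (n : ℕ) : ℝ := 2 ^ (n + 1) / Real.log (3 / 2)

theorem johnNirenbergConst_pos (n : ℕ) : 0 < johnNirenbergConst n :=
  div_pos (by positivity) (Real.log_pos (by norm_num))

theorem IsBMO.exists_real_bound {b : (Fin n → ℝ) → 𝕜} (hb : IsBMO b) (h0 : bmoNorm b ≠ 0) :
    ∃ B : ℝ, 0 < B ∧ bmoNorm b = ENNReal.ofReal B :=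
  ⟨(bmoNorm b).toReal, ENNReal.toReal_pos h0 hb.bmoNorm_lt_top.ne,
    (ENNReal.ofReal_toReal hb.bmoNorm_lt_top.ne).symm⟩

/-- The `L^s` means of the oscillation grow at most linearly in `s`. -/
theorem powerMean_oscillation_le {b : (Fin n → ℝ) → 𝕜} (hb : IsBMO b) {s : ℝ} (hs : 1 ≤ s)
    (Q : Cube n) :
    powerMean s Q (fun x => b x - ⨍ y in Q.toSet, b y) ≤
      ENNReal.ofReal (7 * johnNirenbergConst n) * bmoNorm b * ENNReal.ofReal s := by
  have hs0 : 0 < s := by linarith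
  by_cases h0 : bmoNorm b = 0
  · have : powerMean s Q (fun x => b x - ⨍ y in Q.toSet, b y) = 0 := by
      have h1 : ∫⁻ x in Q.toSet, ‖b x - ⨍ y in Q.toSet, b y‖ₑ ^ s = 0 := by
        rw [lintegral_congr_ae (g := fun _ => 0), lintegral_zero]
        filter_upwards [ae_eq_average_of_bmoNorm_eq_zero hb.locallyIntegrable h0 Q] with x hx
        rw [hx, enorm_zero, ENNReal.zero_rpow_of_pos hs0]
      rw [powerMean, cubeMean, h1, mul_zero, ENNReal.zero_rpow_of_pos (by positivity)]
    rw [this]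
    exact zero_le
  obtain ⟨B, hB, hbB⟩ := hb.exists_real_bound h0
  have hc : 0 < Real.log (3 / 2) := Real.log_pos (by norm_num)
  set c := Real.log (3 / 2) with hcdef
  set D := 2 ^ (n + 1) * B with hD
  have hDpos : 0 < D := by positivity
  set a : 𝕜 := ⨍ y in Q.toSet, b y with ha
  have hpt : ∀ x, ‖b x - a‖ₑ ^ s ≤
      ENNReal.ofReal (s * D / c) ^ s * ENNReal.ofReal (Real.exp (c * (‖b x - a‖ / D))) := by
    intro x
    rw [← ofReal_norm, ENNReal.ofReal_rpow_of_nonneg (norm_nonneg _) hs0.le,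
      ENNReal.ofReal_rpow_of_nonneg (by positivity) hs0.le, ← ENNReal.ofReal_mul (by positivity)]
    refine ENNReal.ofReal_le_ofReal ?_
    -- The bound `t ≤ exp t` is used at `t = c‖b x - a‖ / (D s)`, before taking the power `s`; the
    -- factor `s * D / c` is the source of the linear growth in `s`.
    have h1 : ‖b x - a‖ ≤ s * D / c * Real.exp (c * (‖b x - a‖ / D) / s) := by
      have h2 := Real.add_one_le_exp (c * (‖b x - a‖ / D) / s)
      calc ‖b x - a‖ = s * D / c * (c * (‖b x - a‖ / D) / s) := by field_simp
        _ ≤ _ := by gcongr; linarith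
    calc ‖b x - a‖ ^ s ≤ (s * D / c * Real.exp (c * (‖b x - a‖ / D) / s)) ^ s := by gcongr
      _ = (s * D / c) ^ s * Real.exp (c * (‖b x - a‖ / D)) := by
        rw [Real.mul_rpow (by positivity) (by positivity), ← Real.exp_mul,
          div_mul_cancel₀ _ hs0.ne']
  have hexp := cubeMean_exp_oscillation_le hb.locallyIntegrable hB hbB.le Q
  have hmean : cubeMean Q (fun x => ‖b x - a‖ₑ ^ s) ≤ ENNReal.ofReal (s * D / c) ^ s * 7 := by
    calc cubeMean Q (fun x => ‖b x - a‖ₑ ^ s)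
        ≤ cubeMean Q (fun x => ENNReal.ofReal (s * D / c) ^ s *
            ENNReal.ofReal (Real.exp (c * (‖b x - a‖ / D)))) := by
          unfold cubeMean
          gcongr
          exact hpt _
      _ = ENNReal.ofReal (s * D / c) ^ s *
            cubeMean Q (fun x => ENNReal.ofReal (Real.exp (c * (‖b x - a‖ / D)))) := by
          unfold cubeMean
          rw [lintegral_const_mul' _ _ (ENNReal.rpow_ne_top_of_nonneg hs0.le ENNReal.ofReal_ne_top)]
          ring
      _ ≤ _ := by gcongr
  calc powerMean s Q (fun x => b x - a)
      ≤ (ENNReal.ofReal (s * D / c) ^ s * 7) ^ (1 / s) := by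
        unfold powerMean
        gcongr
    _ = ENNReal.ofReal (s * D / c) * 7 ^ (1 / s) := by
        rw [ENNReal.mul_rpow_of_nonneg _ _ (by positivity), ← ENNReal.rpow_mul,
          mul_one_div_cancel hs0.ne', ENNReal.rpow_one]
    _ ≤ ENNReal.ofReal (s * D / c) * 7 := by
        gcongr
        calc (7 : ℝ≥0∞) ^ (1 / s) ≤ 7 ^ (1 : ℝ) :=
              ENNReal.rpow_le_rpow_of_exponent_le (by norm_num) (by
                rw [div_le_one hs0]; exact hs)
          _ = 7 := ENNReal.rpow_one _
    _ = ENNReal.ofReal (7 * johnNirenbergConst n) * bmoNorm b * ENNReal.ofReal s := by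
        have h7 : (7 : ℝ≥0∞) = ENNReal.ofReal 7 := by norm_num
        rw [hbB, h7, ← ENNReal.ofReal_mul (by positivity),
          ← ENNReal.ofReal_mul (by have := johnNirenbergConst_pos n; positivity),
          ← ENNReal.ofReal_mul (by have := johnNirenbergConst_pos n; positivity)]
        congr 1
        rw [johnNirenbergConst, ← hcdef, hD]
        ring

/-- Young's inequality for the dual pair `s log(e + s)` and the exponential: either `u ≤ log(e +
s)`, or both `s` and `u` are at most `exp u`, whence the exponent `2 * u`. -/
theorem mul_le_mul_log_add_exp {s u : ℝ} (hs : 0 ≤ s) (hu : 0 ≤ u) :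
    s * u ≤ s * Real.log (Real.exp 1 + s) + Real.exp (2 * u) := by
  have he : 0 < Real.exp 1 := Real.exp_pos 1
  have h1 : 1 ≤ Real.exp 1 := Real.one_le_exp (by norm_num)
  rcases le_total u (Real.log (Real.exp 1 + s)) with h | h
  · have := mul_le_mul_of_nonneg_left h hs
    linarith [Real.exp_pos (2 * u)]
  · have h2 : s ≤ Real.exp u := by
      have := (Real.log_le_iff_le_exp (by linarith)).1 h
      linarith
    have h3 : u ≤ Real.exp u := by linarith [Real.add_one_le_exp u]
    have h4 : s * u ≤ Real.exp (2 * u) := by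
      rw [two_mul, Real.exp_add]
      exact mul_le_mul h2 h3 hu (Real.exp_pos u).le
    have h5 : 0 ≤ Real.log (Real.exp 1 + s) := Real.log_nonneg (by linarith)
    nlinarith

/-- The generalized Hölder inequality between `L log L` and the exponential class of `BMO`. -/
theorem cubeMean_oscillation_mul_le {b f : (Fin n → ℝ) → 𝕜} (hb : IsBMO b)
    (hf : AEStronglyMeasurable f volume) (Q : Cube n) :
    cubeMean Q (fun x => ‖(b x - ⨍ y in Q.toSet, b y) * f x‖ₑ) ≤
      ENNReal.ofReal (16 * johnNirenbergConst n) * bmoNorm b * lLogLNorm 1 Q f := by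
  by_cases h0 : bmoNorm b = 0
  · have h1 : ∫⁻ x in Q.toSet, ‖(b x - ⨍ y in Q.toSet, b y) * f x‖ₑ = 0 := by
      rw [lintegral_congr_ae (g := fun _ => 0), lintegral_zero]
      filter_upwards [ae_eq_average_of_bmoNorm_eq_zero hb.locallyIntegrable h0 Q] with x hx
      rw [hx, zero_mul, enorm_zero]
    rw [cubeMean, h1, mul_zero]
    exact zero_le
  obtain ⟨B, hB, hbB⟩ := hb.exists_real_bound h0
  have hc : 0 < Real.log (3 / 2) := Real.log_pos (by norm_num)
  have hκ := johnNirenbergConst_pos n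
  set c := Real.log (3 / 2) with hcdef
  set D := 2 ^ (n + 1) * B with hD
  have hDpos : 0 < D := by positivity
  set a : 𝕜 := ⨍ y in Q.toSet, b y with ha
  have hexp := cubeMean_exp_oscillation_le hb.locallyIntegrable hB hbB.le Q
  rw [hbB, ← ENNReal.ofReal_mul (by positivity)]
  set K := 16 * johnNirenbergConst n * B with hK
  have hKpos : 0 < K := by positivity
  -- Here `8 = 1 + 7` adds the Luxemburg bound to the exponential one, and the factor `2`
  -- compensates the exponent `2 * u` in Young's inequality.
  have hKD : K = 8 * (2 * D / c) := by
    rw [hK, hD, johnNirenbergConst, ← hcdef]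
    ring
  rw [mul_comm (ENNReal.ofReal K),
    ← ENNReal.div_le_iff_le_mul (Or.inl (by simpa using hKpos)) (Or.inl ENNReal.ofReal_ne_top)]
  refine le_iInf fun t => le_iInf fun ht => le_iInf fun htm => ?_
  rw [ENNReal.div_le_iff_le_mul (Or.inl (by simpa using hKpos)) (Or.inl ENNReal.ofReal_ne_top)]
  have hpt : ∀ x, ‖(b x - a) * f x‖ₑ ≤ ENNReal.ofReal (2 * D / c * t) *
      (ENNReal.ofReal (‖f x‖ / t * Real.log (Real.exp 1 + ‖f x‖ / t) ^ (1 : ℝ)) +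
        ENNReal.ofReal (Real.exp (c * (‖b x - a‖ / D)))) := by
    intro x
    have hlog : 0 ≤ Real.log (Real.exp 1 + ‖f x‖ / t) := by
      refine Real.log_nonneg ?_
      have h1 : 1 ≤ Real.exp 1 := Real.one_le_exp (by norm_num)
      have h2 : 0 ≤ ‖f x‖ / t := by positivity
      linarith
    rw [Real.rpow_one, ← ENNReal.ofReal_add (by positivity) (by positivity),
      ← ENNReal.ofReal_mul (by positivity), ← ofReal_norm]
    refine ENNReal.ofReal_le_ofReal ?_
    have h1 := mul_le_mul_log_add_exp (s := ‖f x‖ / t) (u := c * (‖b x - a‖ / D) / 2)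
      (by positivity) (by positivity)
    rw [mul_div_cancel₀ _ (two_ne_zero)] at h1
    calc ‖(b x - a) * f x‖ = 2 * D / c * t * (‖f x‖ / t * (c * (‖b x - a‖ / D) / 2)) := by
          rw [norm_mul]
          field_simp
      _ ≤ _ := by gcongr
  calc cubeMean Q (fun x => ‖(b x - a) * f x‖ₑ)
      ≤ cubeMean Q (fun x => ENNReal.ofReal (2 * D / c * t) *
      (ENNReal.ofReal (‖f x‖ / t * Real.log (Real.exp 1 + ‖f x‖ / t) ^ (1 : ℝ)) +
        ENNReal.ofReal (Real.exp (c * (‖b x - a‖ / D))))) := by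
        unfold cubeMean
        gcongr
        exact hpt _
    _ = ENNReal.ofReal (2 * D / c * t) *
      (cubeMean Q (fun x => ENNReal.ofReal
          (‖f x‖ / t * Real.log (Real.exp 1 + ‖f x‖ / t) ^ (1 : ℝ))) +
        cubeMean Q (fun x => ENNReal.ofReal (Real.exp (c * (‖b x - a‖ / D))))) := by
        unfold cubeMean
        rw [lintegral_const_mul' _ _ ENNReal.ofReal_ne_top, lintegral_add_left']
        · ring
        · refine AEMeasurable.ennreal_ofReal ?_
          have hf' : AEMeasurable (fun x => ‖f x‖ / t) (volume.restrict Q.toSet) :=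
            (hf.norm.aemeasurable.div_const t).restrict
          simp only [Real.rpow_one]
          exact hf'.mul (Real.measurable_log.comp_aemeasurable (hf'.const_add _))
    _ ≤ ENNReal.ofReal (2 * D / c * t) * (1 + 7) := by gcongr
    _ = ENNReal.ofReal t * ENNReal.ofReal K := by
        rw [← ENNReal.ofReal_mul ht.le, hKD]
        have : (1 + 7 : ℝ≥0∞) = ENNReal.ofReal 8 := by norm_num
        rw [this, ← ENNReal.ofReal_mul (by positivity)]
        congr 1
        ring

theorem cubeMean_enorm_le_lLogLNorm_zero (Q : Cube n) (f : (Fin n → ℝ) → 𝕜) :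
    cubeMean Q (fun x => ‖f x‖ₑ) ≤ lLogLNorm 0 Q f := by
  refine le_iInf fun t => le_iInf fun ht => le_iInf fun htm => ?_
  simp only [Real.rpow_zero, mul_one] at htm
  have h1 : cubeMean Q (fun x => ‖f x‖ₑ) =
      ENNReal.ofReal t * cubeMean Q (fun x => ENNReal.ofReal (‖f x‖ / t)) := by
    unfold cubeMean
    rw [mul_left_comm, ← lintegral_const_mul' _ _ ENNReal.ofReal_ne_top]
    congr 2
    ext x
    rw [← ENNReal.ofReal_mul ht.le, mul_div_cancel₀ _ ht.ne', ofReal_norm]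
  rw [h1]
  exact mul_le_of_le_one_right' htm

/-! ### Truncations and the residual of the operator. -/

/-- The class of `F χ_{3Q}`. -/
def truncTriple (Q : Cube n) (F : L1 n 𝕜) : L1 n 𝕜 :=
  ((Lp.memLp F).indicator Q.triple.measurableSet_toSet).toLp _

theorem coeFn_truncTriple (Q : Cube n) (F : L1 n 𝕜) :
    truncTriple Q F =ᵐ[volume] Q.triple.toSet.indicator F := MemLp.coeFn_toLp _

theorem awayFrom_eq_sub (Q : Cube n) (F : L1 n 𝕜) : awayFrom Q F = F - truncTriple Q F := by
  have h : awayFrom Q F =ᵐ[volume] (Q.triple.toSetᶜ).indicator F := MemLp.coeFn_toLp _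
  refine Lp.ext ?_
  filter_upwards [h, coeFn_truncTriple Q F, Lp.coeFn_sub F (truncTriple Q F)] with x h1 h2 h3
  rw [h1, h3, Pi.sub_apply, h2, Set.indicator_compl, Pi.sub_apply]

theorem truncTriple_sub_smul (Q : Cube n) (a : 𝕜) (F G : L1 n 𝕜) :
    truncTriple Q (F - a • G) = truncTriple Q F - a • truncTriple Q G := by
  refine Lp.ext ?_
  filter_upwards [coeFn_truncTriple Q (F - a • G), coeFn_truncTriple Q F, coeFn_truncTriple Q G,
    Lp.coeFn_sub F (a • G), Lp.coeFn_smul a G,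
    Lp.coeFn_sub (truncTriple Q F) (a • truncTriple Q G), Lp.coeFn_smul a (truncTriple Q G)]
    with x h1 h2 h3 h4 h5 h6 h7
  rw [h1, h6, Pi.sub_apply, h7, Pi.smul_apply, h2, h3]
  by_cases hx : x ∈ Q.triple.toSet
  · simp only [Set.indicator_of_mem hx, h4, Pi.sub_apply, h5, Pi.smul_apply]
  · simp only [Set.indicator_of_notMem hx, smul_zero, sub_zero]

theorem truncTriple_truncTriple {P Q : Cube n} (h : P.toSet ⊆ Q.toSet) (F : L1 n 𝕜) :
    truncTriple P (truncTriple Q F) = truncTriple P F := by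
  refine Lp.ext ?_
  filter_upwards [coeFn_truncTriple P (truncTriple Q F), coeFn_truncTriple P F,
    coeFn_truncTriple Q F] with x h1 h2 h3
  rw [h1, h2]
  by_cases hx : x ∈ P.triple.toSet
  · rw [Set.indicator_of_mem hx, Set.indicator_of_mem hx, h3,
      Set.indicator_of_mem (Cube.triple_subset_triple h hx)]
  · rw [Set.indicator_of_notMem hx, Set.indicator_of_notMem hx]

theorem enorm_L1_eq_lintegral (F : L1 n 𝕜) : ‖F‖ₑ = ∫⁻ x, ‖F x‖ₑ := by
  rw [Lp.enorm_def, eLpNorm_one_eq_lintegral_enorm]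

/-- Sums over disjoint cubes have at most one nonzero term at each point, so all identities for such
sums can be checked pointwise without convergence questions. -/
theorem tsum_eq_apply_of_mem {C : Set (Cube n)} (hC : C.PairwiseDisjoint Cube.toSet)
    {x : Fin n → ℝ} {φ : Cube n → 𝕜} (hφ : ∀ P ∈ C, x ∉ P.toSet → φ P = 0) {P : Cube n}
    (hP : P ∈ C) (hx : x ∈ P.toSet) : ∑' P' : C, φ P' = φ P := by
  refine tsum_eq_single (f := fun P' : C => φ P') ⟨P, hP⟩ ?_
  rintro ⟨P', hP'⟩ hne
  refine hφ P' hP' fun hx' => hne ?_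
  exact Subtype.ext (hC.eq hP' hP (Set.not_disjoint_iff.2 ⟨x, hx', hx⟩))

theorem tsum_eq_zero_of_notMem {C : Set (Cube n)}
    {x : Fin n → ℝ} {φ : Cube n → 𝕜} (hφ : ∀ P ∈ C, x ∉ P.toSet → φ P = 0)
    (hx : ∀ P ∈ C, x ∉ P.toSet) : ∑' P' : C, φ P' = 0 := by
  rw [tsum_congr (g := fun _ => 0) fun P' : C => hφ P' P'.2 (hx P' P'.2), tsum_zero]

/-- `T F` minus the localized images `χ_P T(F χ_{3P})`, `P ∈ C`. -/
def residual (T : Operator n 𝕜) (C : Set (Cube n)) (F : L1 n 𝕜) (x : Fin n → ℝ) : 𝕜 :=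
  T F x - ∑' P : C, (P : Cube n).toSet.indicator (T (truncTriple P F)) x

theorem residual_of_notMem (T : Operator n 𝕜) {C : Set (Cube n)} (F : L1 n 𝕜) {x : Fin n → ℝ}
    (hx : x ∉ ⋃ P ∈ C, P.toSet) : residual T C F x = T F x := by
  rw [residual, tsum_eq_zero_of_notMem
    (φ := fun P => P.toSet.indicator (T (truncTriple P F)) x)
    (fun P _ h => Set.indicator_of_notMem h _) (fun P hP h => hx (Set.mem_iUnion₂.2 ⟨P, hP, h⟩)),
    sub_zero]

theorem residual_of_mem (T : Operator n 𝕜) {C : Set (Cube n)}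
    (hC : C.PairwiseDisjoint Cube.toSet) (F : L1 n 𝕜) {P : Cube n} (hP : P ∈ C) {x : Fin n → ℝ}
    (hx : x ∈ P.toSet) : residual T C F x = T F x - T (truncTriple P F) x := by
  rw [residual, tsum_eq_apply_of_mem hC
    (φ := fun P => P.toSet.indicator (T (truncTriple P F)) x)
    (fun P _ h => Set.indicator_of_notMem h _) hP hx, Set.indicator_of_mem hx]

/-- By linearity, removing the local image on `P` leaves the image of the part of `F` outside `3P`,
which is what the maximal operator controls. -/
theorem residual_ae_eq_awayFrom (T : Operator n 𝕜) {C : Set (Cube n)}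
    (hC : C.PairwiseDisjoint Cube.toSet) (F : L1 n 𝕜) {P : Cube n} (hP : P ∈ C) :
    ∀ᵐ x, x ∈ P.toSet → residual T C F x = T (awayFrom P F) x := by
  have h : T (awayFrom P F) = T F - T (truncTriple P F) := by rw [awayFrom_eq_sub, map_sub]
  filter_upwards [AEEqFun.coeFn_sub (T F) (T (truncTriple P F))] with x hx hxP
  rw [residual_of_mem T hC F hP hxP, h, hx, Pi.sub_apply]

theorem lintegral_residual_rpow_le (T : Operator n 𝕜) {p : ℝ} (hp : 1 < p) {Q : Cube n}
    {C : Set (Cube n)} (hCc : C.Countable) (hC : C.PairwiseDisjoint Cube.toSet)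
    (hCQ : ∀ P ∈ C, P.toSet ⊆ Q.toSet) {F : L1 n 𝕜} {M : ℝ≥0∞}
    (hout : ∀ᵐ x, x ∈ Q.toSet → x ∉ ⋃ P ∈ C, P.toSet → ‖T F x‖ₑ ≤ M)
    (hin : ∀ P ∈ C, powerMean p P (T (awayFrom P F)) ≤ M) :
    ∫⁻ x in Q.toSet, ‖residual T C F x‖ₑ ^ p ≤ volume Q.toSet * M ^ p := by
  have hp0 : 0 < p := by linarith
  set U := ⋃ P ∈ C, P.toSet with hU
  have hUm : MeasurableSet U := MeasurableSet.biUnion hCc fun P _ => P.measurableSet_toSet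
  have hUQ : U ⊆ Q.toSet := Set.iUnion₂_subset hCQ
  have h1 : ∫⁻ x in Q.toSet \ U, ‖residual T C F x‖ₑ ^ p ≤ volume (Q.toSet \ U) * M ^ p := by
    calc ∫⁻ x in Q.toSet \ U, ‖residual T C F x‖ₑ ^ p
        ≤ ∫⁻ x in Q.toSet \ U, M ^ p := by
          refine lintegral_mono_ae ?_
          rw [ae_restrict_iff' (Q.measurableSet_toSet.diff hUm)]
          filter_upwards [hout] with x hx hxQ
          rw [residual_of_notMem T F hxQ.2]
          exact ENNReal.rpow_le_rpow (hx hxQ.1 hxQ.2) hp0.le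
      _ = volume (Q.toSet \ U) * M ^ p := by rw [setLIntegral_const, mul_comm]
  have h2 : ∀ P ∈ C, ∫⁻ x in P.toSet, ‖residual T C F x‖ₑ ^ p ≤ volume P.toSet * M ^ p := by
    intro P hP
    have h3 : ∫⁻ x in P.toSet, ‖residual T C F x‖ₑ ^ p =
        ∫⁻ x in P.toSet, ‖T (awayFrom P F) x‖ₑ ^ p := by
      refine lintegral_congr_ae ?_
      rw [Filter.EventuallyEq, ae_restrict_iff' P.measurableSet_toSet]
      filter_upwards [residual_ae_eq_awayFrom T hC F hP] with x hx hxP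
      rw [hx hxP]
    rw [h3, ← Cube.cubeMean_le_iff]
    have h4 := hin P hP
    rwa [powerMean, one_div, ENNReal.rpow_inv_le_iff hp0] at h4
  calc ∫⁻ x in Q.toSet, ‖residual T C F x‖ₑ ^ p
      = (∫⁻ x in U, ‖residual T C F x‖ₑ ^ p) +
          ∫⁻ x in Q.toSet \ U, ‖residual T C F x‖ₑ ^ p := by
        rw [← lintegral_inter_add_sdiff _ Q.toSet hUm, Set.inter_eq_self_of_subset_right hUQ]
    _ ≤ volume U * M ^ p + volume (Q.toSet \ U) * M ^ p := by
        refine add_le_add ?_ h1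
        rw [hU, lintegral_biUnion hCc (fun P _ => P.measurableSet_toSet) hC,
          measure_biUnion hCc hC (fun P _ => P.measurableSet_toSet), ← ENNReal.tsum_mul_right]
        exact ENNReal.tsum_le_tsum fun P => h2 P P.2
    _ = volume Q.toSet * M ^ p := by
        rw [← add_mul, ← measure_inter_add_sdiff Q.toSet hUm,
          Set.inter_eq_self_of_subset_right hUQ]

/-! ### Weak type bounds and the selection of stopping cubes. -/

/-- The weak type inequality at the level `A‖F‖ / v`. If `‖F‖ = 0` this level is `0` and says
nothing, so the set is exhausted by the levels `1 / (k + 1)`. -/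
theorem IsWeakType.volume_lt_le {U : L1 n 𝕜 → (Fin n → ℝ) → ℝ≥0∞} (hU : IsWeakType U 1)
    (F : L1 n 𝕜) {A v : ℝ≥0∞} (hA : A ≠ 0) (hA' : A ≠ ∞) (hv : v ≠ 0) (hv' : v ≠ ∞) :
    volume {x | A * ‖F‖ₑ / v < U F x} ≤ v / A := by
  have hw : ∀ t : ℝ≥0∞, t ≠ ∞ → t * volume {x | t < U F x} ≤ ‖F‖ₑ := by
    intro t ht
    lift t to ℝ≥0 using ht
    have := (le_iSup (fun t : ℝ≥0 => (t : ℝ≥0∞) * volume {x | (t : ℝ≥0∞) < U F x}) t).trans (hU F)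
    rwa [one_mul] at this
  by_cases h0 : ‖F‖ₑ = 0
  · have hz : volume {x | A * ‖F‖ₑ / v < U F x} = 0 := by
      rw [h0, mul_zero, ENNReal.zero_div]
      have hsub : {x | 0 < U F x} ⊆ ⋃ k : ℕ, {x | ((k : ℝ≥0∞) + 1)⁻¹ < U F x} := by
        intro x hx
        obtain ⟨k, hk⟩ := ENNReal.exists_inv_nat_lt (ne_of_gt hx)
        refine Set.mem_iUnion.2 ⟨k, lt_of_le_of_lt ?_ hk⟩
        exact ENNReal.inv_le_inv.2 le_self_add
      refine measure_mono_null hsub (measure_iUnion_null fun k => ?_)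
      have h1 := hw ((k : ℝ≥0∞) + 1)⁻¹ (by simp)
      rw [h0, nonpos_iff_eq_zero, mul_eq_zero] at h1
      refine h1.resolve_left ?_
      refine ENNReal.inv_ne_zero.2 ?_
      exact ENNReal.add_ne_top.2 ⟨ENNReal.natCast_ne_top k, ENNReal.one_ne_top⟩
    rw [hz]
    exact zero_le
  · have hF : ‖F‖ₑ ≠ ∞ := enorm_ne_top
    have h1 := hw (A * ‖F‖ₑ / v) (ENNReal.div_ne_top (ENNReal.mul_ne_top hA' hF) hv)
    rw [ENNReal.le_div_iff_mul_le (Or.inl hA) (Or.inl hA')]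
    set m := volume {x | A * ‖F‖ₑ / v < U F x}
    have h2 : v * (A * ‖F‖ₑ / v * m) ≤ v * ‖F‖ₑ := by gcongr
    have h3 : v * (A * ‖F‖ₑ / v * m) = (m * A) * ‖F‖ₑ := by
      rw [← mul_assoc, ENNReal.mul_div_cancel hv hv']
      ring
    rw [h3] at h2
    exact (ENNReal.mul_le_mul_iff_left h0 hF).1 h2

/-- The stopping cubes of `Q` for two functions. -/
theorem exists_stoppingCubes {p : ℝ} (hp : 1 < p) {T : Operator n 𝕜}
    (hT : IsWeakType (fun f x => ‖T f x‖ₑ) 1) (hM : IsWeakType (lernerMaximal p T) 1)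
    (Q : Cube n) (F₁ F₂ : L1 n 𝕜) :
    ∃ C : Set (Cube n), C.Countable ∧ C.PairwiseDisjoint Cube.toSet ∧
      (∀ P ∈ C, P.toSet ⊆ Q.toSet) ∧
      ∑' P : C, volume (P : Cube n).toSet ≤ 2⁻¹ * volume Q.toSet ∧
      ∀ F, F = F₁ ∨ F = F₂ → ∫⁻ x in Q.toSet, ‖residual T C F x‖ₑ ^ p ≤
        volume Q.toSet * (2 ^ (n + 4) * ‖F‖ₑ / volume Q.toSet) ^ p := by
  set v := volume Q.toSet with hv
  have hv0 : v ≠ 0 := Q.volume_toSet_ne_zero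
  have hv1 : v ≠ ∞ := Q.volume_toSet_ne_top
  have hA0 : (2 : ℝ≥0∞) ^ (n + 4) ≠ 0 := by positivity
  have hA1 : (2 : ℝ≥0∞) ^ (n + 4) ≠ ∞ := by simp
  set exc : L1 n 𝕜 → Set (Fin n → ℝ) := fun F =>
    {x | 2 ^ (n + 4) * ‖F‖ₑ / v < ‖T F x‖ₑ} ∪ {x | 2 ^ (n + 4) * ‖F‖ₑ / v < lernerMaximal p T F x}
    with hexc
  have hexcv : ∀ F, volume (exc F) ≤ v / 2 ^ (n + 4) + v / 2 ^ (n + 4) := fun F =>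
    (measure_union_le _ _).trans (add_le_add (hT.volume_lt_le F hA0 hA1 hv0 hv1)
      (hM.volume_lt_le F hA0 hA1 hv0 hv1))
  -- The measurable hull has the same measure, so measurability of the maximal function is never
  -- needed.
  set E := toMeasurable volume (exc F₁ ∪ exc F₂) with hE
  have hEm : MeasurableSet E := measurableSet_toMeasurable _ _
  have hpow : ∀ k : ℕ, v / 2 ^ (k + 1) + v / 2 ^ (k + 1) = v / 2 ^ k := by
    intro k
    rw [← two_mul, ENNReal.div_eq_inv_mul, ENNReal.div_eq_inv_mul, pow_succ,
      ENNReal.mul_inv (by simp) (by simp)]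
    calc (2 : ℝ≥0∞) * ((2 ^ k)⁻¹ * 2⁻¹ * v) = (2 * 2⁻¹) * ((2 ^ k)⁻¹ * v) := by ring
      _ = _ := by rw [ENNReal.mul_inv_cancel (by simp) (by simp), one_mul]
  -- Four sets, two for each function, of measure at most `v / 2 ^ (n + 4)` each.
  have hEv : volume E ≤ v / 2 ^ (n + 2) := by
    rw [hE, measure_toMeasurable]
    refine (measure_union_le _ _).trans ((add_le_add (hexcv F₁) (hexcv F₂)).trans ?_)
    rw [hpow (n + 3), hpow (n + 2)]
  have hEfin : volume E ≠ ∞ := ne_top_of_le_ne_top (ENNReal.div_ne_top hv1 (by simp)) hEv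
  have hint : LocallyIntegrable (E.indicator fun _ => (1 : ℝ)) volume :=
    ((integrable_indicator_iff hEm).2 (integrableOn_const hEfin)).locallyIntegrable
  have hen : ∀ x, ‖E.indicator (fun _ => (1 : ℝ)) x‖ₑ = E.indicator (fun _ => 1) x := by
    intro x
    by_cases hx : x ∈ E <;> simp [hx]
  have hlint : ∀ P : Cube n, ∫⁻ x in P.toSet, ‖E.indicator (fun _ => (1 : ℝ)) x‖ₑ =
      volume (E ∩ P.toSet) := by
    intro P
    simp_rw [hen]
    rw [lintegral_indicator hEm, setLIntegral_one, Measure.restrict_apply hEm]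
  -- At the height `2 ^ -(n + 1)` the total measure is at most `2 ^ (n + 1) * v / 2 ^ (n + 2) = v /
  -- 2`, while `E` has density at most `2 ^ n * 2 ^ -(n + 1) = 1/2` in every selected cube.
  have hα0 : ((2 : ℝ≥0∞) ^ (n + 1))⁻¹ ≠ 0 := by simp
  have hα1 : ((2 : ℝ≥0∞) ^ (n + 1))⁻¹ ≠ ∞ := by simp
  have hQE : volume (E ∩ Q.toSet) ≤ v / 2 ^ (n + 2) :=
    (measure_mono Set.inter_subset_left).trans hEv
  obtain ⟨C, hCc, hCd, hCs, hCm, hCv, hCa⟩ := exists_calderonZygmund Q hint hα0 hα1 (by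
    rw [Cube.cubeMean_le_iff, hlint]
    refine hQE.trans ?_
    rw [ENNReal.div_eq_inv_mul, mul_comm]
    gcongr
    · norm_num
    · omega)
  refine ⟨C, hCc, hCd, hCs, ?_, ?_⟩
  · refine hCv.trans ?_
    rw [hlint, inv_inv]
    refine (mul_le_mul_right hQE _).trans (le_of_eq ?_)
    rw [ENNReal.div_eq_inv_mul, pow_succ 2 (n + 1), ENNReal.mul_inv (by simp) (by simp)]
    calc (2 : ℝ≥0∞) ^ (n + 1) * ((2 ^ (n + 1))⁻¹ * 2⁻¹ * v)
        = (2 ^ (n + 1) * (2 ^ (n + 1))⁻¹) * (2⁻¹ * v) := by ring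
      _ = 2⁻¹ * v := by rw [ENNReal.mul_inv_cancel (by simp) (by simp), one_mul]
  · intro F hF
    have hsub : exc F ⊆ E := by
      refine Set.Subset.trans ?_ (subset_toMeasurable _ _)
      rcases hF with rfl | rfl
      · exact Set.subset_union_left
      · exact Set.subset_union_right
    refine lintegral_residual_rpow_le T hp hCc hCd hCs ?_ ?_
    -- Almost every point off the selected cubes is outside `E`, since the indicator there is at
    -- most a height below `1`.
    · filter_upwards [hCa] with x hx hxQ hxC
      by_contra hlt
      have hxE : x ∈ E := hsub (Or.inl (not_le.1 hlt))
      have h1 := hx hxQ hxC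
      rw [hen, Set.indicator_of_mem hxE] at h1
      refine absurd h1 (not_le.2 ?_)
      rw [ENNReal.inv_lt_one]
      exact one_lt_pow₀ (by norm_num) (by omega)
    · intro P hP
      have h1 := hCm P hP
      rw [Cube.cubeMean_le_iff, hlint] at h1
      have h2 : (2 : ℝ≥0∞) ^ n * (2 ^ (n + 1))⁻¹ = 2⁻¹ := by
        rw [pow_succ, ENNReal.mul_inv (by simp) (by simp), ← mul_assoc,
          ENNReal.mul_inv_cancel (by simp) (by simp), one_mul]
      rw [h2] at h1
      -- Density `1/2` leaves a point of `P` outside `E`; the maximal function there bounds the mean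
      -- over all of `P`.
      have h3 : ¬ P.toSet ⊆ E := by
        intro hPE
        rw [Set.inter_eq_self_of_subset_right hPE] at h1
        refine absurd h1 (not_le.2 ?_)
        rw [← ENNReal.div_eq_inv_mul.trans (mul_comm _ _)]
        exact ENNReal.half_lt_self P.volume_toSet_ne_zero P.volume_toSet_ne_top
      obtain ⟨x, hxP, hxE⟩ := Set.not_subset.1 h3
      have h4 : lernerMaximal p T F x ≤ 2 ^ (n + 4) * ‖F‖ₑ / v :=
        not_lt.1 fun h => hxE (hsub (Or.inr h))
      refine le_trans ?_ h4
      exact le_iSup₂ (f := fun (P : Cube n) (_ : x ∈ P.toSet) => powerMean p P (T (awayFrom P F)))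
        P hxP

/-! ### The layers of stopping cubes: sparseness and telescoping. -/

/-- Root cubes together with a selection of stopping subcubes for every cube. -/
structure StoppingFamily (n : ℕ) where
  roots : Set (Cube n)
  children : Cube n → Set (Cube n)
  roots_countable : roots.Countable
  roots_disjoint : roots.PairwiseDisjoint Cube.toSet
  children_countable : ∀ Q, (children Q).Countable
  children_disjoint : ∀ Q, (children Q).PairwiseDisjoint Cube.toSet
  children_subset : ∀ Q, ∀ P ∈ children Q, P.toSet ⊆ Q.toSet
  children_volume : ∀ Q, ∑' P : children Q, volume (P : Cube n).toSet ≤ 2⁻¹ * volume Q.toSet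

namespace StoppingFamily

variable (𝓕 : StoppingFamily n)

/-- The cubes obtained from the roots after `k` selections. -/
def layer : ℕ → Set (Cube n)
  | 0 => 𝓕.roots
  | k + 1 => ⋃ Q ∈ layer k, 𝓕.children Q

theorem mem_layer_succ {k : ℕ} {P : Cube n} :
    P ∈ 𝓕.layer (k + 1) ↔ ∃ Q ∈ 𝓕.layer k, P ∈ 𝓕.children Q := by
  simp only [layer, Set.mem_iUnion, exists_prop]

theorem layer_countable (k : ℕ) : (𝓕.layer k).Countable := by
  induction k with
  | zero => exact 𝓕.roots_countable
  | succ k ih => exact ih.biUnion fun Q _ => 𝓕.children_countable Q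

theorem layer_disjoint (k : ℕ) : (𝓕.layer k).PairwiseDisjoint Cube.toSet := by
  induction k with
  | zero => exact 𝓕.roots_disjoint
  | succ k ih =>
    intro P hP P' hP' hne
    obtain ⟨Q, hQ, hPQ⟩ := 𝓕.mem_layer_succ.1 hP
    obtain ⟨Q', hQ', hPQ'⟩ := 𝓕.mem_layer_succ.1 hP'
    refine Set.disjoint_left.2 fun x hx hx' => hne ?_
    obtain rfl : Q = Q' := ih.eq hQ hQ' (Set.not_disjoint_iff.2
      ⟨x, 𝓕.children_subset _ _ hPQ hx, 𝓕.children_subset _ _ hPQ' hx'⟩)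
    exact (𝓕.children_disjoint Q).eq hPQ hPQ' (Set.not_disjoint_iff.2 ⟨x, hx, hx'⟩)

theorem exists_mem_layer_of_le {x : Fin n → ℝ} {k l : ℕ} (hkl : k ≤ l)
    (h : ∃ Q ∈ 𝓕.layer l, x ∈ Q.toSet) : ∃ Q ∈ 𝓕.layer k, x ∈ Q.toSet := by
  induction l, hkl using Nat.le_induction with
  | base => exact h
  | succ l _ ih =>
    obtain ⟨P, hP, hx⟩ := h
    obtain ⟨Q, hQ, hPQ⟩ := 𝓕.mem_layer_succ.1 hP
    exact ih ⟨Q, hQ, 𝓕.children_subset _ _ hPQ hx⟩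

theorem exists_mem_children {x : Fin n → ℝ} {k : ℕ} {Q : Cube n} (hQ : Q ∈ 𝓕.layer k)
    (hx : x ∈ Q.toSet) (h : ∃ P ∈ 𝓕.layer (k + 1), x ∈ P.toSet) :
    ∃ P ∈ 𝓕.children Q, x ∈ P.toSet := by
  obtain ⟨P, hP, hxP⟩ := h
  obtain ⟨Q', hQ', hPQ⟩ := 𝓕.mem_layer_succ.1 hP
  obtain rfl : Q' = Q := (𝓕.layer_disjoint k).eq hQ' hQ (Set.not_disjoint_iff.2
      ⟨x, 𝓕.children_subset _ _ hPQ hxP, hx⟩)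
  exact ⟨P, hPQ, hxP⟩

/-- The part of `Q` outside its stopping subcubes. -/
def exclusive (Q : Cube n) : Set (Fin n → ℝ) := Q.toSet \ ⋃ P ∈ 𝓕.children Q, P.toSet

theorem measurableSet_exclusive (Q : Cube n) : MeasurableSet (𝓕.exclusive Q) :=
  Q.measurableSet_toSet.diff
    (MeasurableSet.biUnion (𝓕.children_countable Q) fun P _ => P.measurableSet_toSet)

/-- A deeper cube through `x` would have an ancestor through `x` one level below `Q`; by
disjointness of the layer this is a stopping subcube of `Q`, which the exclusive part avoids. -/
theorem exclusive_level_le {x : Fin n → ℝ} {k l : ℕ} {Q Q' : Cube n} (hQ : Q ∈ 𝓕.layer k)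
    (hQ' : Q' ∈ 𝓕.layer l) (hx : x ∈ 𝓕.exclusive Q) (hx' : x ∈ Q'.toSet) : l ≤ k := by
  by_contra hlt
  obtain ⟨P, hP, hxP⟩ := 𝓕.exists_mem_children hQ hx.1
    (𝓕.exists_mem_layer_of_le (Nat.succ_le_of_lt (not_le.1 hlt)) ⟨Q', hQ', hx'⟩)
  exact hx.2 (Set.mem_iUnion₂.2 ⟨P, hP, hxP⟩)

theorem half_volume_le_exclusive (Q : Cube n) :
    2⁻¹ * volume Q.toSet ≤ volume (𝓕.exclusive Q) := by
  have h1 : volume Q.toSet ≤ 2⁻¹ * volume Q.toSet + volume (𝓕.exclusive Q) := by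
    rw [← measure_inter_add_sdiff Q.toSet (MeasurableSet.biUnion (𝓕.children_countable Q)
      fun P _ => P.measurableSet_toSet)]
    refine add_le_add ?_ le_rfl
    refine (measure_mono Set.inter_subset_right).trans
      ((measure_biUnion_le _ (𝓕.children_countable Q) _).trans ?_)
    rw [measure_inter_add_sdiff Q.toSet (MeasurableSet.biUnion (𝓕.children_countable Q)
      fun P _ => P.measurableSet_toSet)]
    exact 𝓕.children_volume Q
  have h2 : volume Q.toSet = 2⁻¹ * volume Q.toSet + 2⁻¹ * volume Q.toSet := by
    rw [← add_mul, ENNReal.inv_two_add_inv_two, one_mul]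
  have h3 : 2⁻¹ * volume Q.toSet ≠ ∞ := ENNReal.mul_ne_top (by simp) Q.volume_toSet_ne_top
  nth_rewrite 1 [h2] at h1
  exact (ENNReal.add_le_add_iff_left h3).1 h1

theorem exclusive_nonempty (Q : Cube n) : (𝓕.exclusive Q).Nonempty := by
  refine nonempty_of_measure_ne_zero (μ := volume) fun h => ?_
  have := 𝓕.half_volume_le_exclusive Q
  rw [h, nonpos_iff_eq_zero, mul_eq_zero] at this
  exact this.elim (by simp) Q.volume_toSet_ne_zero

/-- The cubes of all layers, labelled by their level. -/
abbrev Index : Type := Σ k, 𝓕.layer k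

variable {𝓕}

/-- The cube of an index. -/
def Index.cube (i : 𝓕.Index) : Cube n := i.2.1

variable (𝓕)

instance : Countable 𝓕.Index :=
  have : ∀ k, Countable (𝓕.layer k) := fun k => (𝓕.layer_countable k).to_subtype
  inferInstance

theorem index_ext {i j : 𝓕.Index} (hk : i.1 = j.1) (hc : i.cube = j.cube) : i = j := by
  obtain ⟨k, Q, hQ⟩ := i
  obtain ⟨l, Q', hQ'⟩ := j
  obtain rfl : k = l := hk
  obtain rfl : Q = Q' := hc
  rfl

theorem eq_of_mem_exclusive {x : Fin n → ℝ} {i j : 𝓕.Index} (hi : x ∈ 𝓕.exclusive i.cube)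
    (hj : x ∈ 𝓕.exclusive j.cube) : i = j := by
  have hk : i.1 = j.1 := le_antisymm (𝓕.exclusive_level_le j.2.2 i.2.2 hj hi.1)
    (𝓕.exclusive_level_le i.2.2 j.2.2 hi hj.1)
  refine 𝓕.index_ext hk ((𝓕.layer_disjoint i.1).eq i.2.2 (hk ▸ j.2.2)
    (Set.not_disjoint_iff.2 ⟨x, hi.1, hj.1⟩))

/-- No cube occurs at two levels, because its exclusive part is nonempty and determines the index.
Sums over indices are therefore sums over a set of cubes. -/
theorem cube_injective : Function.Injective (Index.cube : 𝓕.Index → Cube n) := by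
  intro i j h
  obtain ⟨x, hx⟩ := 𝓕.exclusive_nonempty i.cube
  exact 𝓕.eq_of_mem_exclusive hx (h ▸ hx)

/-- The threefold dilates of the cubes of all layers. -/
def triples : Set (Cube n) := Set.range fun i : 𝓕.Index => i.cube.triple

/-- The exclusive part of `Q` serves `3Q`: it has measure at least `|Q| / 2 = |3Q| / (2 * 3 ^ n)`,
and exclusive parts of different cubes are disjoint. -/
theorem isSparse_triples : IsSparse (1 / 2 * (1 / 3 ^ n)) 𝓕.triples := by
  refine ⟨fun R => ⋃ (i : 𝓕.Index) (_ : i.cube.triple = R), 𝓕.exclusive i.cube, ?_, ?_⟩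
  · rintro _ ⟨i, rfl⟩
    have h : (⋃ (j : 𝓕.Index) (_ : j.cube.triple = i.cube.triple), 𝓕.exclusive j.cube) =
        𝓕.exclusive i.cube := by
      refine Set.Subset.antisymm (Set.iUnion₂_subset fun j hj => ?_)
        (Set.subset_iUnion₂_of_subset i rfl le_rfl)
      rw [Cube.triple_injective hj]
    simp only [h]
    refine ⟨𝓕.measurableSet_exclusive _, fun x hx => Cube.toSet_subset_triple _ hx.1, ?_⟩
    refine le_trans (le_of_eq ?_) (𝓕.half_volume_le_exclusive i.cube)
    have h3 : ENNReal.ofReal (1 / 2 * (1 / 3 ^ n)) = 2⁻¹ * (3 ^ n)⁻¹ := by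
      rw [one_div, one_div, ENNReal.ofReal_mul (by norm_num),
        ENNReal.ofReal_inv_of_pos (by norm_num), ENNReal.ofReal_inv_of_pos (by positivity),
        ENNReal.ofReal_pow (by norm_num)]
      norm_num
    rw [h3, Cube.volume_triple]
    calc (2⁻¹ : ℝ≥0∞) * (3 ^ n)⁻¹ * (3 ^ n * volume i.cube.toSet)
        = 2⁻¹ * ((3 ^ n)⁻¹ * 3 ^ n) * volume i.cube.toSet := by ring
      _ = _ := by rw [ENNReal.inv_mul_cancel (by simp) (by simp), mul_one]
  · rintro R - R' - hne
    refine Set.disjoint_left.2 fun x hx hx' => hne ?_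
    simp only [Set.mem_iUnion] at hx hx'
    obtain ⟨i, rfl, hi⟩ := hx
    obtain ⟨j, rfl, hj⟩ := hx'
    rw [𝓕.eq_of_mem_exclusive hi hj]

theorem tsum_triple_le (a : Cube n → ℝ≥0∞) :
    ∑' i : 𝓕.Index, a i.cube.triple ≤ ∑' R : 𝓕.triples, a R :=
  ENNReal.tsum_comp_le_tsum_of_injective
    (f := fun i : 𝓕.Index => (⟨i.cube.triple, i, rfl⟩ : 𝓕.triples))
    (fun _ _ h => 𝓕.cube_injective (Cube.triple_injective (congrArg Subtype.val h)))
    (fun R => a R)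

/-- Inside a root the measure of the layers is at least halved each time, so the points that lie in
all layers form a null set. All sums over the cubes are thus finite almost everywhere. -/
theorem ae_exists_layer_notMem : ∀ᵐ x, ∃ K, ∀ Q ∈ 𝓕.layer K, x ∉ Q.toSet := by
  set V : Set (Fin n → ℝ) := {x | ∀ K, ∃ Q ∈ 𝓕.layer K, x ∈ Q.toSet} with hV
  have hle : ∀ m k, ∀ Q ∈ 𝓕.layer k, volume (V ∩ Q.toSet) ≤ 2⁻¹ ^ m * volume Q.toSet := by
    intro m
    induction m with
    | zero =>
      intro k Q _
      simpa using measure_mono Set.inter_subset_right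
    | succ m ih =>
      intro k Q hQ
      calc volume (V ∩ Q.toSet) ≤ volume (⋃ P ∈ 𝓕.children Q, V ∩ P.toSet) := by
            refine measure_mono fun x hx => ?_
            obtain ⟨P, hP, hxP⟩ := 𝓕.exists_mem_children hQ hx.2 (hx.1 (k + 1))
            exact Set.mem_iUnion₂.2 ⟨P, hP, hx.1, hxP⟩
        _ ≤ ∑' P : 𝓕.children Q, volume (V ∩ (P : Cube n).toSet) :=
            measure_biUnion_le _ (𝓕.children_countable Q) _
        _ ≤ ∑' P : 𝓕.children Q, 2⁻¹ ^ m * volume (P : Cube n).toSet :=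
            ENNReal.tsum_le_tsum fun P => ih (k + 1) P (𝓕.mem_layer_succ.2 ⟨Q, hQ, P.2⟩)
        _ = 2⁻¹ ^ m * ∑' P : 𝓕.children Q, volume (P : Cube n).toSet := ENNReal.tsum_mul_left
        _ ≤ 2⁻¹ ^ m * (2⁻¹ * volume Q.toSet) := by gcongr; exact 𝓕.children_volume Q
        _ = 2⁻¹ ^ (m + 1) * volume Q.toSet := by ring
  have hzero : ∀ Q ∈ 𝓕.roots, volume (V ∩ Q.toSet) = 0 := by
    intro Q hQ
    have h1 : Filter.Tendsto (fun m : ℕ => (2⁻¹ : ℝ≥0∞) ^ m * volume Q.toSet) Filter.atTop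
        (nhds (0 * volume Q.toSet)) :=
      ENNReal.Tendsto.mul_const (ENNReal.tendsto_pow_atTop_nhds_zero_of_lt_one
        (by norm_num)) (Or.inr Q.volume_toSet_ne_top)
    rw [zero_mul] at h1
    exact le_antisymm (ge_of_tendsto' h1 fun m => hle m 0 Q hQ) zero_le
  have hVnull : volume V = 0 := by
    refine measure_mono_null (t := ⋃ Q ∈ 𝓕.roots, V ∩ Q.toSet) (fun x hx => ?_)
      ((measure_biUnion_null_iff 𝓕.roots_countable).2 hzero)
    obtain ⟨Q, hQ, hxQ⟩ := hx 0
    exact Set.mem_iUnion₂.2 ⟨Q, hQ, hx, hxQ⟩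
  rw [ae_iff]
  convert hVnull using 2
  ext x
  simp [hV]

variable {𝓕}

theorem finite_index_mem {x : Fin n → ℝ} (hx : ∃ K, ∀ Q ∈ 𝓕.layer K, x ∉ Q.toSet) :
    {i : 𝓕.Index | x ∈ i.cube.toSet}.Finite := by
  obtain ⟨K, hK⟩ := hx
  refine Set.Finite.of_injOn (f := Sigma.fst) (t := Set.Iio K) ?_ ?_ (Set.finite_Iio K)
  · intro i hi
    by_contra hKi
    obtain ⟨Q, hQ, hxQ⟩ := 𝓕.exists_mem_layer_of_le (not_lt.1 hKi) ⟨Index.cube i, i.2.2, hi⟩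
    exact hK Q hQ hxQ
  · intro i hi j hj hij
    exact 𝓕.index_ext hij ((𝓕.layer_disjoint i.1).eq i.2.2 (hij ▸ j.2.2)
      (Set.not_disjoint_iff.2 ⟨x, hi, hj⟩))

theorem summable_of_eq_zero {x : Fin n → ℝ} (hx : ∃ K, ∀ Q ∈ 𝓕.layer K, x ∉ Q.toSet)
    {φ : Cube n → 𝕜} (hφ : ∀ Q, x ∉ Q.toSet → φ Q = 0) :
    Summable fun i : 𝓕.Index => φ i.cube :=
  summable_of_hasFiniteSupport ((finite_index_mem hx).subset fun i hi => by
    by_contra h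
    exact hi (hφ _ h))

/-- At `x` only one cube of the layer counts, and its subcube through `x`, if any, is the only cube
of the next layer through `x`. -/
theorem tsum_layer_sub {x : Fin n → ℝ} {w : Cube n → 𝕜} (hw : ∀ Q, x ∉ Q.toSet → w Q = 0)
    (k : ℕ) : ∑' Q : 𝓕.layer k, (w Q - ∑' P : 𝓕.children Q, w P) =
      ∑' Q : 𝓕.layer k, w Q - ∑' Q : 𝓕.layer (k + 1), w Q := by
  set φ : Cube n → 𝕜 := fun Q => w Q - ∑' P : 𝓕.children Q, w P with hφ
  have hφ0 : ∀ Q ∈ 𝓕.layer k, x ∉ Q.toSet → φ Q = 0 := by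
    intro Q _ hx
    rw [hφ]
    simp only
    rw [hw Q hx, tsum_eq_zero_of_notMem (fun P _ => hw P)
      fun P hP h => hx (𝓕.children_subset Q P hP h), sub_zero]
  by_cases hk : ∃ Q ∈ 𝓕.layer k, x ∈ Q.toSet
  · obtain ⟨Q, hQ, hx⟩ := hk
    rw [tsum_eq_apply_of_mem (𝓕.layer_disjoint k) hφ0 hQ hx,
      tsum_eq_apply_of_mem (𝓕.layer_disjoint k) (fun Q _ => hw Q) hQ hx]
    by_cases hk' : ∃ P ∈ 𝓕.layer (k + 1), x ∈ P.toSet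
    · obtain ⟨P, hP, hxP⟩ := 𝓕.exists_mem_children hQ hx hk'
      rw [hφ]
      simp only
      rw [tsum_eq_apply_of_mem (𝓕.children_disjoint Q) (fun P _ => hw P) hP hxP,
        tsum_eq_apply_of_mem (𝓕.layer_disjoint (k + 1)) (fun P _ => hw P)
          (𝓕.mem_layer_succ.2 ⟨Q, hQ, hP⟩) hxP]
    · push Not at hk'
      rw [hφ]
      simp only
      rw [tsum_eq_zero_of_notMem (fun P _ => hw P) hk',
        tsum_eq_zero_of_notMem (C := 𝓕.children Q) (fun P _ => hw P)
          fun P hP => hk' P (𝓕.mem_layer_succ.2 ⟨Q, hQ, hP⟩)]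
  · have hk' : ¬ ∃ Q ∈ 𝓕.layer (k + 1), x ∈ Q.toSet := fun h =>
      hk (𝓕.exists_mem_layer_of_le (Nat.le_succ k) h)
    push Not at hk hk'
    rw [tsum_eq_zero_of_notMem hφ0 hk, tsum_eq_zero_of_notMem (fun Q _ => hw Q) hk,
      tsum_eq_zero_of_notMem (fun Q _ => hw Q) hk', sub_zero]

/-- Telescoping over the layers. -/
theorem tsum_index_sub {x : Fin n → ℝ} (hx : ∃ K, ∀ Q ∈ 𝓕.layer K, x ∉ Q.toSet)
    {w : Cube n → 𝕜} (hw : ∀ Q, x ∉ Q.toSet → w Q = 0) :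
    ∑' i : 𝓕.Index, (w i.cube - ∑' P : 𝓕.children i.cube, w P) = ∑' Q : 𝓕.roots, w Q := by
  have hsum : Summable fun i : 𝓕.Index => w i.cube - ∑' P : 𝓕.children i.cube, w P :=
    summable_of_eq_zero (φ := fun Q => w Q - ∑' P : 𝓕.children Q, w P) hx fun Q hxQ => by
      rw [hw Q hxQ, tsum_eq_zero_of_notMem (fun P _ => hw P)
        fun P hP h => hxQ (𝓕.children_subset Q P hP h), sub_zero]
  rw [hsum.tsum_sigma]
  have h1 : ∀ k, ∑' Q : 𝓕.layer k, (w (Index.cube ⟨k, Q⟩) -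
      ∑' P : 𝓕.children (Index.cube ⟨k, Q⟩), w P) =
      ∑' Q : 𝓕.layer k, w Q - ∑' Q : 𝓕.layer (k + 1), w Q := fun k => tsum_layer_sub hw k
  rw [tsum_congr h1]
  obtain ⟨K, hK⟩ := hx
  have h2 : ∀ k ≥ K, ∑' Q : 𝓕.layer k, w Q = 0 := fun k hk =>
    tsum_eq_zero_of_notMem (fun Q _ => hw Q) fun Q hQ hxQ => by
      obtain ⟨Q', hQ', hxQ'⟩ := 𝓕.exists_mem_layer_of_le hk ⟨Q, hQ, hxQ⟩
      exact hK Q' hQ' hxQ'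
  rw [tsum_eq_sum (s := Finset.range K) fun k hk => by
    rw [Finset.mem_range, not_lt] at hk
    rw [h2 k hk, h2 (k + 1) (by omega), sub_zero], Finset.sum_range_sub', h2 K le_rfl, sub_zero]
  rfl

end StoppingFamily

/-! ### The partition into root cubes. -/

/-- A partition of `ℝⁿ` into cubes whose threefold dilates contain a given bounded set. -/
theorem exists_partition_subset_triple {K : Set (Fin n → ℝ)} (hK : Bornology.IsBounded K) :
    ∃ R : Set (Cube n), R.Countable ∧ R.PairwiseDisjoint Cube.toSet ∧
      (∀ x, ∃ Q ∈ R, x ∈ Q.toSet) ∧ ∀ Q ∈ R, K ⊆ Q.triple.toSet := by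
  classical
  obtain ⟨ρ, hρ, hKρ⟩ : ∃ ρ : ℝ, 0 < ρ ∧ K ⊆ Metric.ball 0 ρ := by
    obtain ⟨ρ, hρ⟩ := hK.subset_ball_lt 0 0
    exact ⟨ρ, hρ.1, hρ.2⟩
  have h3 : ∀ j : ℕ, 0 < 3 ^ j * ρ := fun j => by positivity
  have hs : ∀ j : ℕ, 0 < 2 * (3 ^ j * ρ) := fun j => by positivity
  -- Grid `j` has the centered box of half side `3 ^ j * ρ` as one of its cells. The next box is the
  -- threefold dilate of this one, hence a union of `3 ^ n` cells of grid `j`.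
  set cell : ℕ → (Fin n → ℝ) → Cube n := fun j x =>
    gridCell (fun _ => -(3 ^ j * ρ)) (2 * (3 ^ j * ρ)) (hs j) x with hcell
  set box : ℕ → (Fin n → ℝ) → Prop := fun j x => ∀ i, -(3 ^ j * ρ) ≤ x i ∧ x i < 3 ^ j * ρ with hbox
  have hmono : ∀ {j k : ℕ} {x}, j ≤ k → box j x → box k x := by
    intro j k x hjk hx i
    have h1 : (3 : ℝ) ^ j * ρ ≤ 3 ^ k * ρ := by
      gcongr
      norm_num
    have := hx i
    constructor <;> linarith
  have hex : ∀ x, ∃ k, box k x := by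
    intro x
    obtain ⟨k, hk⟩ := pow_unbounded_of_one_lt (‖x‖ / ρ) (by norm_num : (1 : ℝ) < 3)
    rw [div_lt_iff₀ hρ] at hk
    refine ⟨k, fun i => ?_⟩
    have h1 := norm_le_pi_norm x i
    rw [Real.norm_eq_abs] at h1
    have h2 := abs_le.1 h1
    constructor <;> linarith
  have hbox0 : ∀ j x, box j x ↔ ∀ i, ⌊(x i - -(3 ^ j * ρ)) / (2 * (3 ^ j * ρ))⌋ = 0 := by
    intro j x
    refine forall_congr' fun i => ?_
    rw [Int.floor_eq_iff, le_div_iff₀ (hs j), div_lt_iff₀ (hs j)]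
    push_cast
    constructor <;> rintro ⟨h1, h2⟩ <;> constructor <;> linarith
  have hbox1 : ∀ j x, box (j + 1) x ↔ ∀ i,
      -1 ≤ ⌊(x i - -(3 ^ j * ρ)) / (2 * (3 ^ j * ρ))⌋ ∧
        ⌊(x i - -(3 ^ j * ρ)) / (2 * (3 ^ j * ρ))⌋ < 2 := by
    intro j x
    refine forall_congr' fun i => ?_
    rw [Int.le_floor, Int.floor_lt, le_div_iff₀ (hs j), div_lt_iff₀ (hs j), pow_succ]
    push_cast
    constructor <;> rintro ⟨h1, h2⟩ <;> constructor <;> linarith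
  set level : (Fin n → ℝ) → ℕ := fun x => Nat.find (hex x) with hlevel
  have hlev : ∀ x, box (level x) x := fun x => Nat.find_spec (hex x)
  -- Cells do not cross the boundary between levels. By truncated subtraction, level `0` (the
  -- innermost box) and level `1` (the first shell) both use grid `0`.
  have hlevel_eq : ∀ x y, y ∈ (cell (level x - 1) x).toSet → level y = level x := by
    intro x y hy
    rw [hcell, mem_gridCell] at hy
    rcases hl : level x with _ | j
    · rw [hl] at hy
      have h1 := hlev x
      rw [hl, hbox0] at h1
      refine (Nat.find_eq_zero (hex y)).2 ((hbox0 0 y).2 fun i => ?_)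
      rw [← h1 i]
      exact hy i
    · rw [hl, Nat.add_sub_cancel] at hy
      have h1 := hlev x
      rw [hl, hbox1] at h1
      refine (Nat.find_eq_iff (hex y)).2 ⟨(hbox1 j y).2 fun i => ?_, fun m hm hm' => ?_⟩
      · rw [hy i]; exact h1 i
      · have h2 : box j y := hmono (Nat.lt_succ_iff.1 hm) hm'
        have h3 : box j x := by
          rw [hbox0] at h2 ⊢
          intro i
          rw [← hy i]; exact h2 i
        have h4 : level x ≤ j := Nat.find_min' (hex x) h3
        omega
  refine ⟨Set.range fun x => cell (level x - 1) x, ?_, ?_, ?_, ?_⟩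
  · refine (Set.countable_iUnion fun j : ℕ =>
      countable_range_gridCell (fun _ : Fin n => -(3 ^ j * ρ)) (2 * (3 ^ j * ρ)) (hs j)).mono ?_
    rintro _ ⟨x, rfl⟩
    exact Set.mem_iUnion.2 ⟨level x - 1, x, rfl⟩
  · rintro _ ⟨x, rfl⟩ _ ⟨y, rfl⟩ hne
    refine Set.disjoint_left.2 fun z hz hz' => hne ?_
    have h1 := hlevel_eq x z hz
    have h2 := hlevel_eq y z hz'
    have h5 : cell (level x - 1) z = cell (level x - 1) x := gridCell_eq_of_mem hz
    have h6 : cell (level y - 1) z = cell (level y - 1) y := gridCell_eq_of_mem hz'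
    simp only
    rw [← h5, ← h6, ← h1, ← h2]
  · intro x
    exact ⟨_, ⟨x, rfl⟩, self_mem_gridCell _ _ _ x⟩
  · rintro _ ⟨x, rfl⟩ z hz
    have h1 : box (level x - 1 + 1) x := hmono (by omega) (hlev x)
    rw [hbox1] at h1
    set j := level x - 1 with hj
    rw [Cube.mem_toSet]
    intro i
    have h2 := hKρ hz
    rw [mem_ball_zero_iff] at h2
    have h4 := norm_le_pi_norm z i
    rw [Real.norm_eq_abs] at h4
    have h6 : ρ ≤ 3 ^ j * ρ := le_mul_of_one_le_left hρ.le (one_le_pow₀ (by norm_num))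
    have h7 : |z i| < ρ := lt_of_le_of_lt h4 h2
    have h8 := abs_lt.1 h7
    obtain ⟨h9, h10⟩ := h1 i
    simp only [Cube.triple_corner, Cube.triple_side, hcell, gridCell]
    -- A cell index in `{-1, 0, 1}` means that the cell is the central box or a neighbor of it, so
    -- its threefold dilate covers the central box and with it `K`.
    set m : ℤ := ⌊(x i - -(3 ^ j * ρ)) / (2 * (3 ^ j * ρ))⌋ with hm
    have hm1 : (-1 : ℝ) ≤ m := by exact_mod_cast h9
    have hm2 : (m : ℝ) ≤ 1 := by exact_mod_cast Int.lt_add_one_iff.1 h10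
    have hj3 := h3 j
    constructor <;> nlinarith

/-! ### Measurability and the commutator identity on one cube. -/

theorem aestronglyMeasurable_tsum {ι : Type*} [Countable ι] {φ : ι → (Fin n → ℝ) → 𝕜}
    (hφ : ∀ i, AEStronglyMeasurable (φ i) volume) (hs : ∀ᵐ x, Summable fun i => φ i x) :
    AEStronglyMeasurable (fun x => ∑' i, φ i x) volume := by
  refine aestronglyMeasurable_of_tendsto_ae (Filter.atTop : Filter (Finset ι))
    (f := fun s x => ∑ i ∈ s, φ i x) (fun s => ?_) ?_
  · exact Finset.aestronglyMeasurable_fun_sum s fun i _ => hφ i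
  · filter_upwards [hs] with x hx
    exact hx.hasSum

theorem aestronglyMeasurable_residual (T : Operator n 𝕜) {C : Set (Cube n)} (hCc : C.Countable)
    (hC : C.PairwiseDisjoint Cube.toSet) (F : L1 n 𝕜) :
    AEStronglyMeasurable (residual T C F) volume := by
  have := hCc.to_subtype
  refine (AEEqFun.aestronglyMeasurable _).sub (aestronglyMeasurable_tsum
    (φ := fun (P : C) x => (P : Cube n).toSet.indicator (T (truncTriple P F)) x)
    (fun P => (AEEqFun.aestronglyMeasurable _).indicator P.1.measurableSet_toSet)
    (Filter.Eventually.of_forall fun x => ?_))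
  refine summable_of_hasFiniteSupport (Set.Subsingleton.finite ?_)
  rintro P hP P' hP'
  refine Subtype.ext (hC.eq P.2 P'.2 (Set.not_disjoint_iff.2 ⟨x, ?_, ?_⟩))
  · by_contra h
    exact hP (Set.indicator_of_notMem h _)
  · by_contra h
    exact hP' (Set.indicator_of_notMem h _)

theorem coeFn_map_sub_smul (T : Operator n 𝕜) (F G : L1 n 𝕜) (a : 𝕜) :
    ∀ᵐ x, T (F - a • G) x = T F x - a * T G x := by
  have h : T (F - a • G) = T F - a • T G := by rw [map_sub, map_smul]
  filter_upwards [AEEqFun.coeFn_sub (T F) (a • T G), AEEqFun.coeFn_smul a (T G)] with x h1 h2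
  rw [h, h1, Pi.sub_apply, h2, Pi.smul_apply, smul_eq_mul]

/-- `χ_Q (b T(F χ_{3Q}) - T(G χ_{3Q}))`. -/
def localCommutator (T : Operator n 𝕜) (b : (Fin n → ℝ) → 𝕜) (F G : L1 n 𝕜) (Q : Cube n)
    (x : Fin n → ℝ) : 𝕜 :=
  Q.toSet.indicator (fun y => b y * T (truncTriple Q F) y - T (truncTriple Q G) y) x

theorem localCommutator_of_notMem (T : Operator n 𝕜) (b : (Fin n → ℝ) → 𝕜) (F G : L1 n 𝕜)
    {Q : Cube n} {x : Fin n → ℝ} (hx : x ∉ Q.toSet) : localCommutator T b F G Q x = 0 :=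
  Set.indicator_of_notMem hx _

/-- The terms containing `a` cancel by linearity, both off the subcubes and on each of them; on a
subcube `P`, truncation to `3Q` followed by truncation to `3P` is truncation to `3P`. -/
theorem residual_sub_residual_ae_eq (T : Operator n 𝕜) (b : (Fin n → ℝ) → 𝕜) (a : 𝕜) (F G : L1 n 𝕜)
    {Q : Cube n} {C : Set (Cube n)} (hCc : C.Countable) (hC : C.PairwiseDisjoint Cube.toSet)
    (hCQ : ∀ P ∈ C, P.toSet ⊆ Q.toSet) :
    ∀ᵐ x, x ∈ Q.toSet → (b x - a) * residual T C (truncTriple Q F) x +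
      -residual T C (truncTriple Q G - a • truncTriple Q F) x =
      localCommutator T b F G Q x - ∑' P : C, localCommutator T b F G P x := by
  filter_upwards [coeFn_map_sub_smul T (truncTriple Q G) (truncTriple Q F) a,
    (ae_ball_iff hCc).2 fun P (_ : P ∈ C) =>
      coeFn_map_sub_smul T (truncTriple P G) (truncTriple P F) a] with x h1 h2 hx
  by_cases hxC : x ∈ ⋃ P ∈ C, P.toSet
  · obtain ⟨P, hP, hxP⟩ := Set.mem_iUnion₂.1 hxC
    rw [residual_of_mem T hC _ hP hxP, residual_of_mem T hC _ hP hxP, truncTriple_sub_smul,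
      truncTriple_truncTriple (hCQ P hP), truncTriple_truncTriple (hCQ P hP), h1, h2 P hP,
      tsum_eq_apply_of_mem hC (φ := fun P => localCommutator T b F G P x)
        (fun P _ h => localCommutator_of_notMem T b F G h) hP hxP]
    simp only [localCommutator, Set.indicator_of_mem hx, Set.indicator_of_mem hxP]
    ring
  · rw [residual_of_notMem T _ hxC, residual_of_notMem T _ hxC, h1,
      tsum_eq_zero_of_notMem (φ := fun P => localCommutator T b F G P x)
        (fun P _ h => localCommutator_of_notMem T b F G h)
        (fun P hP h => hxC (Set.mem_iUnion₂.2 ⟨P, hP, h⟩))]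
    simp only [localCommutator, Set.indicator_of_mem hx]
    ring

theorem truncTriple_toLp_eq_self {f : (Fin n → ℝ) → 𝕜} (hf : MemLp f 1 volume) {Q : Cube n}
    (h : ∀ x ∉ Q.triple.toSet, f x = 0) : truncTriple Q (hf.toLp f) = hf.toLp f := by
  refine Lp.ext ?_
  filter_upwards [coeFn_truncTriple Q (hf.toLp f), hf.coeFn_toLp] with x h1 h2
  rw [h1]
  by_cases hx : x ∈ Q.triple.toSet
  · rw [Set.indicator_of_mem hx]
  · rw [Set.indicator_of_notMem hx, h2, h x hx]

/-! ### Hölder's inequality and the bounds for single pieces. -/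

theorem cubeMean_eq_lintegral (Q : Cube n) (F : (Fin n → ℝ) → ℝ≥0∞) :
    cubeMean Q F = ∫⁻ x, F x ∂((volume Q.toSet)⁻¹ • volume.restrict Q.toSet) := by
  rw [lintegral_smul_measure, cubeMean, smul_eq_mul]

/-- Hölder's inequality for power means. -/
theorem powerMean_mul_le {s r : ℝ} (hs : 0 < s) (hr : 1 < r) {F G : (Fin n → ℝ) → 𝕜}
    (hF : AEStronglyMeasurable F volume) (hG : AEStronglyMeasurable G volume) (Q : Cube n) :
    powerMean s Q (fun x => F x * G x) ≤
      powerMean (r.conjExponent * s) Q F * powerMean (r * s) Q G := by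
  have hc := (Real.HolderConjugate.conjExponent hr).symm
  have hr' : 0 < r.conjExponent := hc.pos
  have hr0 : 0 < r := by linarith
  set μ := (volume Q.toSet)⁻¹ • volume.restrict Q.toSet with hμ
  have hm : ∀ {F : (Fin n → ℝ) → 𝕜}, AEStronglyMeasurable F volume →
      AEMeasurable (fun x => ‖F x‖ₑ ^ s) μ := fun hF =>
    (hF.restrict.enorm.pow_const s).smul_measure _
  have h1 := ENNReal.lintegral_mul_le_Lp_mul_Lq μ hc (hm hF) (hm hG)
  have h2 : cubeMean Q (fun x => ‖F x * G x‖ₑ ^ s) ≤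
      cubeMean Q (fun x => ‖F x‖ₑ ^ (r.conjExponent * s)) ^ (1 / r.conjExponent) *
        cubeMean Q (fun x => ‖G x‖ₑ ^ (r * s)) ^ (1 / r) := by
    simp only [cubeMean_eq_lintegral]
    refine le_trans (le_of_eq ?_) (h1.trans (le_of_eq ?_))
    · refine lintegral_congr fun x => ?_
      rw [Pi.mul_apply, enorm_mul, ENNReal.mul_rpow_of_nonneg _ _ hs.le]
    · simp only [← ENNReal.rpow_mul]
      rw [mul_comm s r, mul_comm s r.conjExponent]
  unfold powerMean
  refine (ENNReal.rpow_le_rpow h2 (by positivity)).trans (le_of_eq ?_)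
  rw [ENNReal.mul_rpow_of_nonneg _ _ (by positivity), ← ENNReal.rpow_mul, ← ENNReal.rpow_mul,
    one_div_mul_one_div, one_div_mul_one_div]

theorem setLIntegral_mul_le_powerMean_triple {p : ℝ} (hp : 1 < p) {Q : Cube n}
    {R G : (Fin n → ℝ) → 𝕜} (hR : AEStronglyMeasurable R volume)
    (hG : AEStronglyMeasurable G volume) {M : ℝ≥0∞}
    (h : ∫⁻ x in Q.toSet, ‖R x‖ₑ ^ p ≤ volume Q.toSet * M ^ p) :
    ∫⁻ x in Q.toSet, ‖R x‖ₑ * ‖G x‖ₑ ≤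
      M * (volume Q.triple.toSet * powerMean p.conjExponent Q.triple G) := by
  have hc := Real.HolderConjugate.conjExponent hp
  have hp0 : 0 < p := by linarith
  have hp' : 0 < p.conjExponent := hc.symm.pos
  set v := volume Q.triple.toSet with hv
  have hv0 : v ≠ 0 := Q.triple.volume_toSet_ne_zero
  have hv1 : v ≠ ∞ := Q.triple.volume_toSet_ne_top
  have h1 := ENNReal.lintegral_mul_le_Lp_mul_Lq (volume.restrict Q.toSet) hc
    hR.restrict.enorm hG.restrict.enorm
  have h2 : (∫⁻ x in Q.toSet, ‖R x‖ₑ ^ p) ^ (1 / p) ≤ v ^ (1 / p) * M := by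
    calc (∫⁻ x in Q.toSet, ‖R x‖ₑ ^ p) ^ (1 / p) ≤ (v * M ^ p) ^ (1 / p) := by
          refine ENNReal.rpow_le_rpow (h.trans ?_) (by positivity)
          gcongr
          exact measure_mono (Cube.toSet_subset_triple Q)
      _ = v ^ (1 / p) * M := by
          rw [ENNReal.mul_rpow_of_nonneg _ _ (by positivity), ← ENNReal.rpow_mul,
            mul_one_div_cancel hp0.ne', ENNReal.rpow_one]
  have h3 : (∫⁻ x in Q.toSet, ‖G x‖ₑ ^ p.conjExponent) ^ (1 / p.conjExponent) ≤
      v ^ (1 / p.conjExponent) * powerMean p.conjExponent Q.triple G := by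
    rw [powerMean, ← ENNReal.mul_rpow_of_nonneg _ _ (by positivity), Cube.volume_mul_cubeMean]
    exact ENNReal.rpow_le_rpow (lintegral_mono_set (Cube.toSet_subset_triple Q)) (by positivity)
  have h4 : v ^ (1 / p) * v ^ (1 / p.conjExponent) = v := by
    rw [← ENNReal.rpow_add _ _ hv0 hv1, one_div, one_div, hc.inv_add_inv_eq_one, ENNReal.rpow_one]
  refine h1.trans ((mul_le_mul' h2 h3).trans (le_of_eq ?_))
  calc v ^ (1 / p) * M * (v ^ (1 / p.conjExponent) * powerMean p.conjExponent Q.triple G)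
      = M * ((v ^ (1 / p) * v ^ (1 / p.conjExponent)) * powerMean p.conjExponent Q.triple G) := by
        ring
    _ = _ := by rw [h4]

theorem IsLocLp.aestronglyMeasurable {s : ℝ} {g : (Fin n → ℝ) → 𝕜} (hg : IsLocLp s g) :
    AEStronglyMeasurable g volume := by
  have h : (⋃ k : ℕ, Metric.closedBall (0 : Fin n → ℝ) k) = Set.univ :=
    Metric.iUnion_closedBall_nat 0
  rw [← Measure.restrict_univ (μ := volume), ← h, aestronglyMeasurable_iUnion_iff]
  exact fun k => (hg _ (isCompact_closedBall _ _)).aestronglyMeasurable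

/-- The estimate is for the integral of the modulus, so it yields integrability as well as the bound
once the sparse form is finite. -/
theorem lintegral_tsum_pieces_le (𝓕 : StoppingFamily n) {piece : Cube n → (Fin n → ℝ) → 𝕜}
    (hpiece : ∀ Q, AEStronglyMeasurable (piece Q) volume) {g : (Fin n → ℝ) → 𝕜}
    (hg : AEStronglyMeasurable g volume) {K : ℝ≥0∞} {a : Cube n → ℝ≥0∞}
    (h : ∀ Q, ∫⁻ x, ‖piece Q x * g x‖ₑ ≤ K * a Q.triple) :
    ∫⁻ x, ‖(∑' i : 𝓕.Index, piece i.cube x) * g x‖ₑ ≤ K * ∑' R : 𝓕.triples, a R := by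
  calc ∫⁻ x, ‖(∑' i : 𝓕.Index, piece i.cube x) * g x‖ₑ
      ≤ ∫⁻ x, ∑' i : 𝓕.Index, ‖piece i.cube x * g x‖ₑ := by
        refine lintegral_mono fun x => ?_
        simp only [enorm_mul, ENNReal.tsum_mul_right]
        gcongr
        exact enorm_tsum_le_tsum_enorm
    _ = ∑' i : 𝓕.Index, ∫⁻ x, ‖piece i.cube x * g x‖ₑ :=
        lintegral_tsum fun i => ((hpiece _).mul hg).enorm
    _ ≤ ∑' i : 𝓕.Index, K * a i.cube.triple := ENNReal.tsum_le_tsum fun i => h i.cube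
    _ = K * ∑' i : 𝓕.Index, a i.cube.triple := ENNReal.tsum_mul_left
    _ ≤ K * ∑' R : 𝓕.triples, a R := by gcongr; exact 𝓕.tsum_triple_le a

theorem integrable_and_enorm_integral_le {H : (Fin n → ℝ) → 𝕜}
    (hH : AEStronglyMeasurable H volume) {K A : ℝ≥0∞} (hK : K ≠ ∞)
    (h : ∫⁻ x, ‖H x‖ₑ ≤ K * A) :
    (A < ∞ → Integrable H volume) ∧ ‖∫ x, H x‖ₑ ≤ K * A :=
  ⟨fun hA => ⟨hH, h.trans_lt (ENNReal.mul_lt_top hK.lt_top hA)⟩,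
    (enorm_integral_le_lintegral_enorm _).trans h⟩

theorem div_volume_eq (Q : Cube n) (F : (Fin n → ℝ) → ℝ≥0∞) :
    2 ^ (n + 4) * (∫⁻ x in Q.triple.toSet, F x) / volume Q.toSet =
      2 ^ (n + 4) * 3 ^ n * cubeMean Q.triple F := by
  rw [← Cube.volume_mul_cubeMean, Cube.volume_triple, ENNReal.div_eq_inv_mul]
  calc (volume Q.toSet)⁻¹ * (2 ^ (n + 4) * (3 ^ n * volume Q.toSet * cubeMean Q.triple F))
      = ((volume Q.toSet)⁻¹ * volume Q.toSet) * (2 ^ (n + 4) * 3 ^ n * cubeMean Q.triple F) := by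
        ring
    _ = _ := by
        rw [ENNReal.inv_mul_cancel Q.volume_toSet_ne_zero Q.volume_toSet_ne_top, one_mul]

theorem enorm_truncTriple_toLp {f : (Fin n → ℝ) → 𝕜} (hf : MemLp f 1 volume) (Q : Cube n) :
    ‖truncTriple Q (hf.toLp f)‖ₑ = ∫⁻ x in Q.triple.toSet, ‖f x‖ₑ := by
  rw [enorm_L1_eq_lintegral, ← lintegral_indicator Q.triple.measurableSet_toSet]
  refine lintegral_congr_ae ?_
  filter_upwards [coeFn_truncTriple Q (hf.toLp f), hf.coeFn_toLp] with x h1 h2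
  rw [h1]
  by_cases hx : x ∈ Q.triple.toSet
  · rw [Set.indicator_of_mem hx, Set.indicator_of_mem hx, h2]
  · rw [Set.indicator_of_notMem hx, Set.indicator_of_notMem hx, enorm_zero]

theorem enorm_truncTriple_sub_smul_toLp {b f : (Fin n → ℝ) → 𝕜} (hf : MemLp f 1 volume)
    (hbf : MemLp (fun x => b x * f x) 1 volume) (a : 𝕜) (Q : Cube n) :
    ‖truncTriple Q (hbf.toLp _) - a • truncTriple Q (hf.toLp f)‖ₑ =
      ∫⁻ x in Q.triple.toSet, ‖(b x - a) * f x‖ₑ := by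
  have hmem : MemLp (fun x => (b x - a) * f x) 1 volume := by
    have := hbf.sub (hf.const_smul a)
    convert this using 1
    ext x
    simp [sub_mul]
  rw [← truncTriple_sub_smul, ← enorm_truncTriple_toLp hmem]
  congr 2
  rw [← MemLp.toLp_const_smul, ← MemLp.toLp_sub]
  congr 1
  ext x
  simp [sub_mul]

/-- The dimensional constant of the sparse bounds. -/
def sparseConst (n : ℕ) : ℝ≥0∞ :=
  2 ^ (n + 4) * 3 ^ n * ENNReal.ofReal (16 * johnNirenbergConst n)

theorem sparseConst_ne_top (n : ℕ) : sparseConst n ≠ ∞ :=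
  ENNReal.mul_ne_top (ENNReal.mul_ne_top (by simp) (by simp)) ENNReal.ofReal_ne_top

/-- Hölder with `p`, `p'` separates the residual from `(b - β) g`, and Hölder with `r`, `r'`
separates `b - β` from `g`; the mean oscillation then costs `r'p'`. -/
theorem lintegral_oscillation_piece_le {b f g : (Fin n → ℝ) → 𝕜} (hb : IsBMO b) {p r : ℝ}
    (hp : 1 < p) (hr : 1 < r) (hf : MemLp f 1 volume) (hg : AEStronglyMeasurable g volume)
    {Q : Cube n} {R : (Fin n → ℝ) → 𝕜} (hR : AEStronglyMeasurable R volume)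
    (h : ∫⁻ x in Q.toSet, ‖R x‖ₑ ^ p ≤ volume Q.toSet *
      (2 ^ (n + 4) * ‖truncTriple Q (hf.toLp f)‖ₑ / volume Q.toSet) ^ p) :
    ∫⁻ x, ‖Q.toSet.indicator (fun y => (b y - ⨍ z in Q.triple.toSet, b z) * R y) x * g x‖ₑ ≤
      sparseConst n * bmoNorm b * ENNReal.ofReal (r.conjExponent * p.conjExponent) *
        (volume Q.triple.toSet * lLogLNorm 0 Q.triple f *
          powerMean (r * p.conjExponent) Q.triple g) := by
  have hp' : 1 < p.conjExponent := (Real.HolderConjugate.conjExponent hp).symm.lt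
  have hr' : 1 < r.conjExponent := (Real.HolderConjugate.conjExponent hr).symm.lt
  have hκ := johnNirenbergConst_pos n
  set a : 𝕜 := ⨍ z in Q.triple.toSet, b z with ha
  have hba : AEStronglyMeasurable (fun x => b x - a) volume :=
    hb.locallyIntegrable.aestronglyMeasurable.sub aestronglyMeasurable_const
  rw [enorm_truncTriple_toLp, div_volume_eq] at h
  have h1 := setLIntegral_mul_le_powerMean_triple hp hR (hba.mul hg) h
  have h2 := powerMean_mul_le (by linarith : 0 < p.conjExponent) hr hba hg Q.triple
  have h3 := powerMean_oscillation_le hb (s := r.conjExponent * p.conjExponent)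
    (by nlinarith) Q.triple
  calc ∫⁻ x, ‖Q.toSet.indicator (fun y => (b y - a) * R y) x * g x‖ₑ
      = ∫⁻ x in Q.toSet, ‖R x‖ₑ * ‖(b x - a) * g x‖ₑ := by
        rw [← lintegral_indicator Q.measurableSet_toSet]
        refine lintegral_congr fun x => ?_
        by_cases hx : x ∈ Q.toSet
        · simp only [Set.indicator_of_mem hx, enorm_mul]
          ring
        · simp only [Set.indicator_of_notMem hx, zero_mul, enorm_zero]
    _ ≤ 2 ^ (n + 4) * 3 ^ n * lLogLNorm 0 Q.triple f * (volume Q.triple.toSet *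
          (ENNReal.ofReal (16 * johnNirenbergConst n) * bmoNorm b *
            ENNReal.ofReal (r.conjExponent * p.conjExponent) *
              powerMean (r * p.conjExponent) Q.triple g)) := by
        refine h1.trans ?_
        gcongr
        · exact cubeMean_enorm_le_lLogLNorm_zero _ _
        · refine h2.trans ?_
          gcongr
          refine h3.trans ?_
          gcongr
          -- Here `7 ≤ 16`: the larger constant of the `L log L` estimate serves both forms.
          norm_num
    _ = _ := by
        rw [sparseConst]
        ring

/-- The oscillation of `b` sits in the argument of `T` and enters only through `‖(b - β) f
χ_{3Q}‖₁`, so `g` keeps the exponent `p'`. -/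
theorem lintegral_orlicz_piece_le {b f g : (Fin n → ℝ) → 𝕜} (hb : IsBMO b) {p : ℝ}
    (hp : 1 < p) (hf : MemLp f 1 volume) (hbf : MemLp (fun x => b x * f x) 1 volume)
    (hg : AEStronglyMeasurable g volume)
    {Q : Cube n} {R : (Fin n → ℝ) → 𝕜} (hR : AEStronglyMeasurable R volume)
    (h : ∫⁻ x in Q.toSet, ‖R x‖ₑ ^ p ≤ volume Q.toSet *
      (2 ^ (n + 4) * ‖truncTriple Q (hbf.toLp _) -
        (⨍ z in Q.triple.toSet, b z) • truncTriple Q (hf.toLp f)‖ₑ / volume Q.toSet) ^ p) :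
    ∫⁻ x, ‖Q.toSet.indicator (fun y => -R y) x * g x‖ₑ ≤
      sparseConst n * bmoNorm b *
        (volume Q.triple.toSet * lLogLNorm 1 Q.triple f *
          powerMean p.conjExponent Q.triple g) := by
  rw [enorm_truncTriple_sub_smul_toLp, div_volume_eq] at h
  have h1 := setLIntegral_mul_le_powerMean_triple hp hR hg h
  calc ∫⁻ x, ‖Q.toSet.indicator (fun y => -R y) x * g x‖ₑ
      = ∫⁻ x in Q.toSet, ‖R x‖ₑ * ‖g x‖ₑ := by
        rw [← lintegral_indicator Q.measurableSet_toSet]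
        refine lintegral_congr fun x => ?_
        by_cases hx : x ∈ Q.toSet
        · simp only [Set.indicator_of_mem hx, enorm_mul, enorm_neg]
        · simp only [Set.indicator_of_notMem hx, zero_mul, enorm_zero]
    _ ≤ 2 ^ (n + 4) * 3 ^ n * (ENNReal.ofReal (16 * johnNirenbergConst n) * bmoNorm b *
          lLogLNorm 1 Q.triple f) *
          (volume Q.triple.toSet * powerMean p.conjExponent Q.triple g) := by
        refine h1.trans ?_
        gcongr
        exact cubeMean_oscillation_mul_le hb hf.aestronglyMeasurable _
    _ = _ := by
        rw [sparseConst]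
        ring

end SparseCommutator

end

/-! ### The sparse domination theorem. -/

open SparseCommutator
theorem mainTheorem3 (n : ℕ) (hn : 2 ≤ n) :
    ∃ C : ℝ≥0, ∀ (𝕜 : Type*) [RCLike 𝕜] (p₀ r : ℝ), 1 < p₀ → 1 < r →
      ∀ (b : (Fin n → ℝ) → 𝕜) (hb : IsBMO b) (T : Operator n 𝕜),
        IsWeakType (fun f x => ‖T f x‖ₑ) 1 →
        IsWeakType (lernerMaximal p₀ T) 1 →
        ∀ (f : (Fin n → ℝ) → 𝕜) (hf : IsBddCompactSupp f),
          ∃ (S : Set (Cube n)) (H₁ H₂ : (Fin n → ℝ) → 𝕜),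
            IsSparse (1 / 2 * (1 / 3 ^ n)) S ∧
            AEStronglyMeasurable H₁ volume ∧ AEStronglyMeasurable H₂ volume ∧
            (∀ g : (Fin n → ℝ) → 𝕜, IsLocLp (r * p₀.conjExponent) g →
              ((sparseForm S 0 (r * p₀.conjExponent) f g < ∞ →
                  Integrable (fun x => H₁ x * g x) volume) ∧
                ‖∫ x, H₁ x * g x‖ₑ ≤
                  C * bmoNorm b * ENNReal.ofReal (r.conjExponent * p₀.conjExponent) *
                    sparseForm S 0 (r * p₀.conjExponent) f g) ∧
              ((sparseForm S 1 p₀.conjExponent f g < ∞ →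
                  Integrable (fun x => H₂ x * g x) volume) ∧
                ‖∫ x, H₂ x * g x‖ₑ ≤
                  C * bmoNorm b * sparseForm S 1 p₀.conjExponent f g)) ∧
            ∀ᵐ x, symbolCommutator T hb hf x = H₁ x + H₂ x := by
  refine ⟨(sparseConst n).toNNReal, ?_⟩
  rw [ENNReal.coe_toNNReal (sparseConst_ne_top n)]
  intro 𝕜 _ p₀ r hp hr b hb T hT hM f hf
  have hf1 := hf.memLp_one
  have hbf1 := hf.memLp_mul hb.locallyIntegrable
  set β : Cube n → 𝕜 := fun Q => ⨍ z in Q.triple.toSet, b z with hβ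
  set F₁ : Cube n → L1 n 𝕜 := fun Q => truncTriple Q (hf1.toLp f) with hF₁
  set F₂ : Cube n → L1 n 𝕜 := fun Q =>
    truncTriple Q (hbf1.toLp _) - β Q • truncTriple Q (hf1.toLp f) with hF₂
  choose ch hchc hchd hchs hchv hchr using fun Q =>
    exists_stoppingCubes hp hT hM Q (F₁ Q) (F₂ Q)
  obtain ⟨roots, hrc, hrd, hrcov, hrsupp⟩ :=
    exists_partition_subset_triple hf.hasCompactSupport.isCompact.isBounded
  let 𝓕 : StoppingFamily n := ⟨roots, ch, hrc, hrd, hchc, hchd, hchs, hchv⟩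
  set piece₁ : Cube n → (Fin n → ℝ) → 𝕜 := fun Q =>
    Q.toSet.indicator fun y => (b y - β Q) * residual T (ch Q) (F₁ Q) y with hpiece₁
  set piece₂ : Cube n → (Fin n → ℝ) → 𝕜 := fun Q =>
    Q.toSet.indicator fun y => -residual T (ch Q) (F₂ Q) y with hpiece₂
  have hm₁ : ∀ Q, AEStronglyMeasurable (piece₁ Q) volume := fun Q =>
    ((hb.locallyIntegrable.aestronglyMeasurable.sub aestronglyMeasurable_const).mul
      (aestronglyMeasurable_residual T (hchc Q) (hchd Q) _)).indicator Q.measurableSet_toSet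
  have hm₂ : ∀ Q, AEStronglyMeasurable (piece₂ Q) volume := fun Q =>
    (aestronglyMeasurable_residual T (hchc Q) (hchd Q) _).neg.indicator Q.measurableSet_toSet
  have hz₁ : ∀ x Q, x ∉ Q.toSet → piece₁ Q x = 0 := fun x Q hx => Set.indicator_of_notMem hx _
  have hz₂ : ∀ x Q, x ∉ Q.toSet → piece₂ Q x = 0 := fun x Q hx => Set.indicator_of_notMem hx _
  have hH₁ : AEStronglyMeasurable (fun x => ∑' i : 𝓕.Index, piece₁ i.cube x) volume := by
    refine aestronglyMeasurable_tsum (fun i => hm₁ i.cube) ?_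
    filter_upwards [𝓕.ae_exists_layer_notMem] with x hx
    exact StoppingFamily.summable_of_eq_zero (φ := fun Q => piece₁ Q x) hx (hz₁ x)
  have hH₂ : AEStronglyMeasurable (fun x => ∑' i : 𝓕.Index, piece₂ i.cube x) volume := by
    refine aestronglyMeasurable_tsum (fun i => hm₂ i.cube) ?_
    filter_upwards [𝓕.ae_exists_layer_notMem] with x hx
    exact StoppingFamily.summable_of_eq_zero (φ := fun Q => piece₂ Q x) hx (hz₂ x)
  refine ⟨𝓕.triples, _, _, 𝓕.isSparse_triples, hH₁, hH₂, fun g hg => ⟨?_, ?_⟩, ?_⟩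
  · refine integrable_and_enorm_integral_le (hH₁.mul hg.aestronglyMeasurable)
      (ENNReal.mul_ne_top (ENNReal.mul_ne_top (sparseConst_ne_top n) hb.bmoNorm_lt_top.ne)
        ENNReal.ofReal_ne_top) ?_
    exact lintegral_tsum_pieces_le 𝓕 hm₁ hg.aestronglyMeasurable
      (a := fun R => volume R.toSet * lLogLNorm 0 R f * powerMean (r * p₀.conjExponent) R g)
      fun Q => lintegral_oscillation_piece_le hb hp hr hf1 hg.aestronglyMeasurable
        (aestronglyMeasurable_residual T (hchc Q) (hchd Q) _) (hchr Q _ (Or.inl rfl))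
  · refine integrable_and_enorm_integral_le (hH₂.mul hg.aestronglyMeasurable)
      (ENNReal.mul_ne_top (sparseConst_ne_top n) hb.bmoNorm_lt_top.ne) ?_
    exact lintegral_tsum_pieces_le 𝓕 hm₂ hg.aestronglyMeasurable
      (a := fun R => volume R.toSet * lLogLNorm 1 R f * powerMean p₀.conjExponent R g)
      fun Q => lintegral_orlicz_piece_le hb hp hf1 hbf1 hg.aestronglyMeasurable
        (aestronglyMeasurable_residual T (hchc Q) (hchd Q) _) (hchr Q _ (Or.inr rfl))
  · have hae : ∀ᵐ x, ∀ i : 𝓕.Index, x ∈ i.cube.toSet → _ := ae_all_iff.2 fun i =>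
      residual_sub_residual_ae_eq T b (β i.cube) (hf1.toLp f) (hbf1.toLp _)
        (hchc i.cube) (hchd i.cube) (hchs i.cube)
    filter_upwards [𝓕.ae_exists_layer_notMem, hae] with x hx hxi
    set w : Cube n → 𝕜 := fun Q => localCommutator T b (hf1.toLp f) (hbf1.toLp _) Q x with hw
    have hw0 : ∀ Q, x ∉ Q.toSet → w Q = 0 := fun Q h => localCommutator_of_notMem T b _ _ h
    rw [← (StoppingFamily.summable_of_eq_zero (φ := fun Q => piece₁ Q x) hx (hz₁ x)).tsum_add
      (StoppingFamily.summable_of_eq_zero (φ := fun Q => piece₂ Q x) hx (hz₂ x))]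
    -- At each cube the two pieces add up to the telescoping difference, so summing over all indices
    -- leaves only the roots.
    have hsum : ∀ i : 𝓕.Index, piece₁ i.cube x + piece₂ i.cube x =
        w i.cube - ∑' P : 𝓕.children i.cube, w P := by
      intro i
      by_cases hxQ : x ∈ i.cube.toSet
      · simp only [hpiece₁, hpiece₂, Set.indicator_of_mem hxQ]
        exact hxi i hxQ
      · rw [hz₁ x _ hxQ, hz₂ x _ hxQ, hw0 _ hxQ, tsum_eq_zero_of_notMem (fun P _ => hw0 P)
          fun P hP h => hxQ (𝓕.children_subset _ P hP h), add_zero, sub_zero]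
    rw [tsum_congr hsum, StoppingFamily.tsum_index_sub hx hw0]
    -- Only the root through `x` contributes; its threefold dilate contains the support of `f`, so
    -- both truncations are void there.
    obtain ⟨Q, hQ, hxQ⟩ := hrcov x
    have hf0 : ∀ y ∉ Q.triple.toSet, f y = 0 := fun y hy =>
      image_eq_zero_of_notMem_tsupport fun h => hy (hrsupp Q hQ h)
    rw [tsum_eq_apply_of_mem 𝓕.roots_disjoint (fun Q _ => hw0 Q) hQ hxQ, hw]
    simp only [localCommutator, Set.indicator_of_mem hxQ]
    rw [truncTriple_toLp_eq_self hf1 hf0, truncTriple_toLp_eq_self hbf1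
      (fun y hy => by rw [hf0 y hy, mul_zero])]
    rfl
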